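/- **Theorem (Characterization of relative ergodicity for hyperfinite equivalence relations).** Let $X$ be a standard Borel space with a finite Borel measure $\mu$, let $E$ be a Borel equivalence relation on $X$ (not necessarily countable), and let $F \subseteq E$ be a $\mu$-preserving hyperfinite equivalence relation. Here *hyperfinite* means that $F=\bigcup_n F_n$ for some increasing sequence $(F_n)_n$ of Borel equivalence relations with finite classes (a *witness* to the hyperfiniteness of $F$), and *$\mu$-preserving* means that $\mu(A)=\mu(B)$ for every Borel bijection $A \to B$ between Borel sets whose graph is contained in $F$. For a finite Borel equivalence relation $F'$ (one with finite classes) and $f : X \to \mathbb{R}$, let $A_{F'}f(x) := \frac{1}{|[x]_{F'}|}\sum_{y \in [x]_{F'}} f(y)$. A function or set is *$E$-invariant modulo $\mu$-null* if its restriction to $X\setminus Z$ is invariant under $E|_{X \setminus Z}$ for some $\mu$-null Borel set $Z$ (not necessarily $E$-invariant). $F$ is *$\mu$-ergodic within $E$* if every $F$-invariant Borel set is $E$-invariant modulo $\mu$-null. A finite Borel $F' \subseteq E$ *$\varepsilon$-ties $f$ within $E$* if there is an $F'$-invariant Borel set $X' \subseteq X$ with $\mu(X \setminus X') \le \varepsilon$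 such that, for every $x \in X'$, $\sup A_{F'}f - \inf A_{F'}f < \varepsilon$, the supremum and infimum being taken over $[x]_E \cap X'$. An increasing sequence $(F_n)_n$ of finite Borel subequivalence relations of $E$ is *$f$-Cauchy within $E$* if for every $\varepsilon>0$ some $F_n$ $\varepsilon$-ties $f$ within $E$. The relation $F$ is *$f$-Cauchy within $E$* if for every $\varepsilon > 0$ every finite Borel equivalence relation $F_0 \subseteq F$ is contained in a finite Borel equivalence relation $F_1 \subseteq F$ that $\varepsilon$-ties $f$ within $E$. Let $\mathcal{D}$ be a family of bounded Borel functions $X \to \mathbb{R}$ that is dense in $L^1(X,\mu)$. Then for every $f \in \mathcal{D}$ the hyperfinite mean $A_F f := \lim_n A_{F_n} f$ exists $\mu$-a.e. for every witness $(F_n)_n$ to the hyperfiniteness of $F$, and up to a $\mu$-null set it does not depend on the witness. Moreover, the following are equivalent: 1. $F$ is $\mu$-ergodic within $E$. 2. For every $f \in \mathcal{D}$, the hyperfinite mean $A_F f$ is $E$-invariant modulo $\mu$-null. 3. For every $f \in \mathcal{D}$, every witness to the hyperfiniteness of $F$ is $f$-Cauchy within $E$. 4. For every $f \in \mathcal{D}$,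 $F$ is $f$-Cauchy within $E$. 5. For every $f \in \mathcal{D}$, some witness to the hyperfiniteness of $F$ is $f$-Cauchy within $E$. 6. There is an increasing sequence $(F_n)_n$ of finite Borel subequivalence relations of $F$ that is $f$-Cauchy within $E$ for all $f \in \mathcal{D}$. -/

import Mathlib

open MeasureTheory Filter Topology

noncomputable section

namespace RelErg

variable {X : Type*}

/-- The set `A` is invariant under the equivalence relation `F` (a union of `F`-classes). -/
def InvariantSet (F : Setoid X) (A : Set X) : Prop :=
  ∀ x y, F x y → (x ∈ A ↔ y ∈ A)

/-- The oscillation `sup f - inf f` of `f` over the set `A`, computed in the extended reals. -/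
def osc (f : X → ℝ) (A : Set X) : EReal :=
  (⨆ y ∈ A, (f y : EReal)) - ⨅ y ∈ A, (f y : EReal)

/-- For `F` with finite classes: the average of `f` over the `F`-class of `x`. -/
def finiteMean (F : Setoid X) (f : X → ℝ) (x : X) : ℝ :=
  (∑ᶠ y ∈ {y | F x y}, f y) / ({y | F x y}.ncard : ℝ)

variable [MeasurableSpace X]

/-- `E` is Borel as a subset of `X × X`. -/
def IsBorel (E : Setoid X) : Prop :=
  MeasurableSet {p : X × X | E p.1 p.2}

/-- `F` is a Borel equivalence relation all of whose classes are finite. -/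
def IsFiniteBorel (F : Setoid X) : Prop :=
  IsBorel F ∧ ∀ x, {y | F x y}.Finite

/-- `(Fn)` is an increasing sequence of finite Borel equivalence relations with union `F`. -/
def IsWitness (Fn : ℕ → Setoid X) (F : Setoid X) : Prop :=
  (∀ n, IsFiniteBorel (Fn n)) ∧ Monotone Fn ∧ ∀ x y, F x y ↔ ∃ n, Fn n x y

/-- `F` is hyperfinite. -/
def IsHyperfinite (F : Setoid X) : Prop :=
  ∃ Fn : ℕ → Setoid X, IsWitness Fn F

/-- `F` is `μ`-preserving: every partial Borel bijection `φ : A → B` between Borel sets whose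
graph is contained in `F` satisfies `μ A = μ B`. -/
def IsPreserving (F : Setoid X) (μ : Measure X) : Prop :=
  ∀ (A B : Set X) (φ : X → X), MeasurableSet A → MeasurableSet B → Measurable φ →
    Set.BijOn φ A B → (∀ x ∈ A, F x (φ x)) → μ A = μ B

open Classical in
/-- The mean of `f` over a hyperfinite `F`: the pointwise limit of the finite means of `f` along
a chosen witness to the hyperfiniteness of `F`. -/
def hyperfiniteMean (F : Setoid X) (f : X → ℝ) (x : X) : ℝ :=
  if h : IsHyperfinite F then
    limUnder atTop (fun n => finiteMean (h.choose n) f x)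
  else 0

/-- The function `g` is `E`-invariant after a `μ`-null Borel set, which need not be
`E`-invariant, is removed from `X`. -/
def AEInvariant (E : Setoid X) (μ : Measure X) (g : X → ℝ) : Prop :=
  ∃ Z : Set X, MeasurableSet Z ∧ μ Z = 0 ∧ ∀ x ∉ Z, ∀ y ∉ Z, E x y → g x = g y

/-- The set `A` is `E`-invariant after a `μ`-null Borel set, which need not be
`E`-invariant, is removed from `X`. -/
def AEInvariantSet (E : Setoid X) (μ : Measure X) (A : Set X) : Prop :=
  ∃ Z : Set X, MeasurableSet Z ∧ μ Z = 0 ∧ ∀ x ∉ Z, ∀ y ∉ Z, E x y → (x ∈ A ↔ y ∈ A)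

/-- `F` is `μ`-ergodic within `E`. -/
def ErgodicWithin (F E : Setoid X) (μ : Measure X) : Prop :=
  ∀ A : Set X, MeasurableSet A → InvariantSet F A → AEInvariantSet E μ A

/-- The finite Borel equivalence relation `F` `ε`-ties `f` within `E`. -/
def Ties (F E : Setoid X) (μ : Measure X) (f : X → ℝ) (ε : ℝ) : Prop :=
  ∃ X' : Set X, MeasurableSet X' ∧ InvariantSet F X' ∧ μ X'ᶜ ≤ ENNReal.ofReal ε ∧
    ∀ x ∈ X', osc (finiteMean F f) {y | y ∈ X' ∧ E x y} < (ε : EReal)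

/-- The increasing sequence `(Fn)` of finite Borel equivalence relations contained in `E`
is `f`-Cauchy within `E`. -/
def SeqCauchyWithin (Fn : ℕ → Setoid X) (E : Setoid X) (μ : Measure X) (f : X → ℝ) : Prop :=
  ∀ ε : ℝ, 0 < ε → ∃ n, Ties (Fn n) E μ f ε

/-- The equivalence relation `F` contained in `E` is `f`-Cauchy within `E`. -/
def CauchyWithin (F E : Setoid X) (μ : Measure X) (f : X → ℝ) : Prop :=
  ∀ ε : ℝ, 0 < ε → ∀ F₀ : Setoid X, IsFiniteBorel F₀ → F₀ ≤ F →
    ∃ F₁ : Setoid X, IsFiniteBorel F₁ ∧ F₀ ≤ F₁ ∧ F₁ ≤ F ∧ Ties F₁ E μ f ε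

end RelErg

end

/-!
Mass transport along the finite classes (made measurable by Lusin–Novikov) shows that a
`μ`-preserving finite Borel relation `G` averages: the mean of `f` over the `G`-classes is the
conditional expectation of `f` on the σ-algebra of `G`-invariant sets. Along a witness to the
hyperfiniteness of `F` these σ-algebras decrease to that of the `F`-invariant sets, so by reverse
martingale convergence the hyperfinite mean of `f` is the conditional expectation of `f` on the
`F`-invariant sets. Ergodicity therefore makes hyperfinite means `E`-invariant, and convergence in
measure to an `E`-invariant limit is what makes a witness Cauchy. Conversely, tying is stable under
`L¹` approximation, so if a dense family can be tied then so can the indicator of an `F`-invariant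
set `A`; as that indicator is its own mean and takes only two values, `A` is almost `E`-invariant.
-/

namespace RelErg

section Novikov

theorem cylinder_induction {E : ℕ → Type*} [∀ n, Nonempty (E n)] {P : Set (∀ n, E n) → Prop}
    (step : ∀ z k, (∀ a, P (PiNat.cylinder (Function.update z k a) (k + 1))) →
      P (PiNat.cylinder z k))
    (bar : ∀ z, ∃ k, P (PiNat.cylinder z k)) : P Set.univ := by
  by_contra hP
  have next : ∀ z k, ∃ a, ¬ P (PiNat.cylinder z k) →
      ¬ P (PiNat.cylinder (Function.update z k a) (k + 1)) := fun z k => by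
    by_contra! h
    exact (h (Classical.arbitrary _)).1 (step z k fun a => (h a).2)
  choose a ha using next
  let p : ℕ → ∀ n, E n := fun k => Nat.rec (fun _ => Classical.arbitrary _)
    (fun k z => Function.update z k (a z k)) k
  have not_P_cylinder : ∀ k, ¬ P (PiNat.cylinder (p k) k) := fun k => by
    induction k with
    | zero => simpa using hP
    | succ k ih => exact ha _ _ ih
  let z : ∀ n, E n := fun i => p (i + 1) i
  have eq_of_lt : ∀ k, ∀ i < k, z i = p k i := fun k i hi => by
    induction k, hi using Nat.le_induction with
    | base => rfl
    | succ k hik ih =>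
      rw [ih]
      exact (Function.update_of_ne (Nat.ne_of_lt hik) _ _).symm
  obtain ⟨k, hk⟩ := bar z
  rw [PiNat.mem_cylinder_iff_eq.1 (PiNat.mem_cylinder_iff.2 (eq_of_lt k))] at hk
  exact not_P_cylinder k hk

variable {ι α : Type*} [MeasurableSpace α]

/-- The sets `A i` are separated from having a common point by measurable sets: they are
contained in measurable sets with empty intersection. For two sets this is Mathlib's
`MeasureTheory.MeasurablySeparable`. -/
def MeasurablySeparableFamily (A : ι → Set α) : Prop :=
  ∃ B : ι → Set α, (∀ i, MeasurableSet (B i)) ∧ (∀ i, A i ⊆ B i) ∧ ⋂ i, B i = ∅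

theorem MeasurablySeparableFamily.of_subset_iUnion {A : ι → Set α} {S : ℕ → ι → Set α} (i₀ : ι)
    (hS₀ : A i₀ ⊆ ⋃ m, S m i₀) (hS : ∀ m, ∀ i ≠ i₀, A i ⊆ S m i)
    (h : ∀ m, MeasurablySeparableFamily (S m)) : MeasurablySeparableFamily A := by
  classical
  choose B hB hSB hBe using h
  refine ⟨Function.update (fun i => ⋂ m, B m i) i₀ (⋃ m, B m i₀), fun i => ?_, fun i => ?_, ?_⟩
  · obtain rfl | hi := eq_or_ne i i₀
    · simpa using MeasurableSet.iUnion fun m => hB m i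
    · simpa [hi] using MeasurableSet.iInter fun m => hB m i
  · obtain rfl | hi := eq_or_ne i i₀
    · simpa using hS₀.trans (Set.iUnion_mono fun m => hSB m i)
    · simpa [hi] using fun m => (hS m i hi).trans (hSB m i)
  · refine Set.eq_empty_iff_forall_notMem.2 fun x hx => ?_
    rw [Set.mem_iInter] at hx
    obtain ⟨m, hm⟩ : ∃ m, x ∈ B m i₀ := by simpa using hx i₀
    suffices hxB : x ∈ ⋂ i, B m i by simp [hBe m] at hxB
    refine Set.mem_iInter.2 fun i => ?_
    obtain rfl | hi := eq_or_ne i i₀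
    · exact hm
    · have : ∀ m, x ∈ B m i := by simpa [hi] using hx i
      exact this m

theorem MeasurablySeparableFamily.of_disjoint {A : ι → Set α} {U V : Set α} (i j : ι)
    (hU : MeasurableSet U) (hV : MeasurableSet V) (hUV : Disjoint U V) (hi : A i ⊆ U)
    (hj : A j ⊆ V) : MeasurablySeparableFamily A := by
  classical
  refine ⟨fun k => (if k = i then U else Set.univ) ∩ (if k = j then V else Set.univ),
    fun k => ?_, fun k => Set.subset_inter ?_ ?_, ?_⟩
  · exact (MeasurableSet.ite' (fun _ => hU) fun _ => .univ).inter
      (MeasurableSet.ite' (fun _ => hV) fun _ => .univ)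
  · split_ifs with h
    exacts [h ▸ hi, Set.subset_univ _]
  · split_ifs with h
    exacts [h ▸ hj, Set.subset_univ _]
  · refine Set.eq_empty_iff_forall_notMem.2 fun x hx => ?_
    rw [Set.mem_iInter] at hx
    exact Set.disjoint_left.1 hUV (by simpa using (hx i).1) (by simpa using (hx j).2)

variable [TopologicalSpace α] [T2Space α] [OpensMeasurableSpace α]

theorem measurablySeparableFamily_range {f : ℕ → (ℕ → ℕ) → α} (hf : ∀ n, Continuous (f n))
    (hfe : ⋂ n, Set.range (f n) = ∅) :
    MeasurablySeparableFamily fun n => Set.range (f n) := by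
  -- a single sequence `z` codes an argument of every `f n`, so that bar induction applies
  let g : ℕ → (ℕ → ℕ) → α := fun n z => f n fun j => z (Nat.pair n j)
  have g_update : ∀ n k, n ≠ k.unpair.1 → ∀ z a, g n (Function.update z k a) = g n z :=
    fun n k hnk z a => congrArg (f n) <| funext fun j =>
      Function.update_of_ne (fun h => hnk (by rw [← h, Nat.unpair_pair])) _ _
  have g_continuous : ∀ n, Continuous (g n) := fun n => (hf n).comp (by fun_prop)
  have range_g : ∀ n, g n '' Set.univ = Set.range (f n) := fun n => by
    refine Set.image_univ.trans (Set.Subset.antisymm (Set.range_subset_iff.2 fun z => ⟨_, rfl⟩)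
      (Set.range_subset_iff.2 fun x => ⟨fun k => x k.unpair.2, ?_⟩))
    simp [g]
  suffices h : MeasurablySeparableFamily fun n => g n '' Set.univ by simpa only [range_g] using h
  refine cylinder_induction (P := fun W => MeasurablySeparableFamily fun n => g n '' W)
    (fun z k h => ?_) fun z => ?_
  · refine .of_subset_iUnion k.unpair.1 ?_ (fun a n hn => ?_) h
    · rw [← PiNat.iUnion_cylinder_update z k, Set.image_iUnion]
    · rintro _ ⟨w, hw, rfl⟩
      refine ⟨Function.update w k a, PiNat.mem_cylinder_iff.2 fun i hi => ?_, g_update n k hn w a⟩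
      obtain rfl | hik := eq_or_ne i k
      · simp
      · simpa [hik] using PiNat.mem_cylinder_iff.1 hw i (by omega)
  · obtain ⟨i, j, hij⟩ : ∃ i j, g i z ≠ g j z := by
      by_contra! h
      have hz : g 0 z ∈ ⋂ n, Set.range (f n) := Set.mem_iInter.2 fun n => ⟨_, h n 0⟩
      simp [hfe] at hz
    obtain ⟨U, V, hU, hV, hiU, hjV, hUV⟩ := t2_separation hij
    have hW : g i ⁻¹' U ∩ g j ⁻¹' V ∈ 𝓝 z := Filter.inter_mem
      ((g_continuous i).continuousAt (hU.mem_nhds hiU))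
      ((g_continuous j).continuousAt (hV.mem_nhds hjV))
    obtain ⟨_, ⟨y, k, rfl⟩, hzk, hkW⟩ := (PiNat.isTopologicalBasis_cylinders _).mem_nhds_iff.1 hW
    rw [← PiNat.mem_cylinder_iff_eq.1 hzk] at hkW
    exact ⟨k, .of_disjoint i j hU.measurableSet hV.measurableSet hUV
      (Set.image_subset_iff.2 fun w hw => (hkW hw).1)
      (Set.image_subset_iff.2 fun w hw => (hkW hw).2)⟩

/-- **Novikov's separation theorem**. -/
theorem measurablySeparableFamily_of_analyticSet {A : ℕ → Set α} (hA : ∀ n, AnalyticSet (A n))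
    (hAe : ⋂ n, A n = ∅) : MeasurablySeparableFamily A := by
  by_cases hne : ∃ n, A n = ∅
  · obtain ⟨n, hn⟩ := hne
    exact .of_disjoint n n .empty .empty disjoint_bot_left hn.le hn.le
  push Not at hne
  choose f hf hfA using fun n => by
    have := hA n
    rw [AnalyticSet] at this
    exact this.resolve_left (hne n).ne_empty
  obtain rfl : (fun n => Set.range (f n)) = A := funext hfA
  exact measurablySeparableFamily_range hf hAe

end Novikov

section FiniteSections

theorem exists_measurableSet_subset_iUnion_eq {α : Type*} [MeasurableSpace α]
    [TopologicalSpace α] [T2Space α] [OpensMeasurableSpace α] {R : Set α} (hR : MeasurableSet R)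
    {C : ℕ → Set α} (hRC : R ⊆ ⋃ n, C n) (hC : ∀ n, AnalyticSet (R \ C n)) :
    ∃ D : ℕ → Set α, (∀ n, MeasurableSet (D n)) ∧ (∀ n, D n ⊆ C n) ∧ ⋃ n, D n = R := by
  obtain ⟨B, hB, hCB, hBe⟩ := measurablySeparableFamily_of_analyticSet hC
    (by rw [← Set.sdiff_iUnion, Set.sdiff_eq_empty.2 hRC])
  refine ⟨fun n => R \ B n, fun n => hR.diff (hB n), fun n x hx => ?_, ?_⟩
  · by_contra h
    exact hx.2 (hCB n ⟨hx.1, h⟩)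
  · rw [← Set.sdiff_iInter, hBe, Set.sdiff_empty]

variable {X Y : Type*} [MeasurableSpace Y]

theorem count_section_of_injOn_fst [MeasurableSingletonClass Y] {C : Set (X × Y)}
    (hC : Set.InjOn Prod.fst C) (x : X) :
    Measure.count (Prod.mk x ⁻¹' C) = (Prod.fst '' C).indicator 1 x := by
  by_cases hx : x ∈ Prod.fst '' C
  · obtain ⟨⟨x, y⟩, hp, rfl⟩ := hx
    have : Prod.mk x ⁻¹' C = {y} := Set.eq_singleton_iff_unique_mem.2
      ⟨hp, fun y' hy' => congrArg Prod.snd (hC hy' hp rfl)⟩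
    rw [this, Measure.count_singleton, Set.indicator_of_mem (Set.mem_image_of_mem _ hp)]
    rfl
  · have : Prod.mk x ⁻¹' C = ∅ :=
      Set.eq_empty_iff_forall_notMem.2 fun y hy => hx ⟨(x, y), hy, rfl⟩
    rw [this, measure_empty, Set.indicator_of_notMem hx]

theorem count_section_iUnion [MeasurableSpace X] {C : ℕ → Set (X × Y)}
    (hC : ∀ n, MeasurableSet (C n)) (hCd : Pairwise (Function.onFun Disjoint C)) (x : X) :
    Measure.count (Prod.mk x ⁻¹' ⋃ n, C n) = ∑' n, Measure.count (Prod.mk x ⁻¹' C n) := by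
  rw [Set.preimage_iUnion]
  exact measure_iUnion (fun m n hmn => (hCd hmn).preimage _) fun n => measurable_prodMk_left (hC n)

variable [StandardBorelSpace Y]

variable (Y) in
theorem exists_measurableSet_isolating : ∃ U : ℕ → Set Y, (∀ n, MeasurableSet (U n)) ∧
    ∀ S : Set Y, S.Finite → ∀ y ∈ S, ∃ n, y ∈ U n ∧ ∀ y' ∈ U n, y' ∈ S → y' = y := by
  let := upgradeStandardBorel Y
  have hBasis := TopologicalSpace.isBasis_countableBasis Y
  obtain ⟨U, hU⟩ := ((TopologicalSpace.countable_countableBasis Y).insert ∅).exists_eq_range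
    (Set.insert_nonempty _ _)
  refine ⟨U, fun n => ?_, fun S hS y _ => ?_⟩
  · obtain h | h : U n ∈ insert ∅ (TopologicalSpace.countableBasis Y) := hU ▸ Set.mem_range_self n
    · exact h ▸ MeasurableSet.empty
    · exact (TopologicalSpace.isOpen_of_mem_countableBasis h).measurableSet
  · obtain ⟨V, hV, hyV, hVS⟩ := hBasis.exists_subset_of_mem_open (a := y) (u := (S \ {y})ᶜ)
      (by simp) hS.sdiff.isClosed.isOpen_compl
    obtain ⟨n, rfl⟩ : V ∈ Set.range U := hU ▸ Set.mem_insert_of_mem _ hV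
    exact ⟨n, hyV, fun y' hy' hS' => by simpa [hS'] using hVS hy'⟩

variable [MeasurableSpace X] [StandardBorelSpace X] {R : Set (X × Y)}

/-- A special case of the Lusin–Novikov uniformization theorem. -/
theorem exists_iUnion_injOn_fst (hR : MeasurableSet R) (hfin : ∀ x, {y | (x, y) ∈ R}.Finite) :
    ∃ C : ℕ → Set (X × Y), (∀ n, MeasurableSet (C n)) ∧ (∀ n, Set.InjOn Prod.fst (C n)) ∧
      ⋃ n, C n = R := by
  let := upgradeStandardBorel X
  let := upgradeStandardBorel Y
  obtain ⟨U, hU, hUfin⟩ := exists_measurableSet_isolating Y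
  let C : ℕ → Set (X × Y) := fun n => {p | p.2 ∈ U n ∧ ∀ y ∈ U n, (p.1, y) ∈ R → y = p.2}
  have hRC : R ⊆ ⋃ n, C n := fun p hp => by
    obtain ⟨n, hn⟩ := hUfin _ (hfin p.1) p.2 hp
    exact Set.mem_iUnion.2 ⟨n, hn⟩
  let T : ℕ → Set ((X × Y) × Y) := fun n =>
    {q | q.1 ∈ R ∧ (q.1.2 ∉ U n ∨ (q.2 ∈ U n ∧ (q.1.1, q.2) ∈ R ∧ q.2 ≠ q.1.2))}
  have hT : ∀ n, MeasurableSet (T n) := fun n => by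
    refine (measurable_fst hR).inter (((measurable_snd.comp measurable_fst) (hU n)).compl.union
      ((measurable_snd (hU n)).inter ((((measurable_fst.comp measurable_fst).prodMk
        measurable_snd) hR).inter ?_)))
    exact (measurableSet_eq_fun measurable_snd (measurable_snd.comp measurable_fst)).compl
  have image_T : ∀ n, Prod.fst '' T n = R \ C n := fun n => by
    ext p
    constructor
    · rintro ⟨⟨p, y⟩, ⟨hp, h | ⟨hy, hyR, hne⟩⟩, rfl⟩
      exacts [⟨hp, fun hC => h hC.1⟩, ⟨hp, fun hC => hne (hC.2 y hy hyR)⟩]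
    · rintro ⟨hp, hC⟩
      by_cases hpU : p.2 ∈ U n
      · obtain ⟨y, hy, hyR, hne⟩ : ∃ y ∈ U n, (p.1, y) ∈ R ∧ y ≠ p.2 := by
          by_contra! h
          exact hC ⟨hpU, h⟩
        exact ⟨(p, y), ⟨hp, Or.inr ⟨hy, hyR, hne⟩⟩, rfl⟩
      · exact ⟨(p, p.2), ⟨hp, Or.inl hpU⟩, rfl⟩
  obtain ⟨D, hD, hDC, hDR⟩ := exists_measurableSet_subset_iUnion_eq hR hRC fun n =>
    image_T n ▸ (hT n).analyticSet_image measurable_fst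
  refine ⟨D, hD, fun n => ?_, hDR⟩
  rintro ⟨x, y⟩ hp ⟨x', y'⟩ hp' (rfl : x = x')
  have hp'R : (x, y') ∈ R := hDR ▸ Set.mem_iUnion.2 ⟨n, hp'⟩
  rw [(hDC n hp).2 y' (hDC n hp').1 hp'R]

theorem measurableSet_image_fst_of_finite (hR : MeasurableSet R)
    (hfin : ∀ x, {y | (x, y) ∈ R}.Finite) : MeasurableSet (Prod.fst '' R) := by
  obtain ⟨C, hC, hCi, rfl⟩ := exists_iUnion_injOn_fst hR hfin
  rw [Set.image_iUnion]
  exact MeasurableSet.iUnion fun n => (hC n).image_of_measurable_injOn measurable_fst (hCi n)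

theorem measurable_count_section (hR : MeasurableSet R) (hfin : ∀ x, {y | (x, y) ∈ R}.Finite) :
    Measurable fun x => Measure.count (Prod.mk x ⁻¹' R) := by
  obtain ⟨C, hC, hCi, rfl⟩ := exists_iUnion_injOn_fst hR hfin
  have hD : ∀ n, MeasurableSet (disjointed C n) := fun n => .disjointed hC n
  have hDi : ∀ n, Set.InjOn Prod.fst (disjointed C n) := fun n =>
    (hCi n).mono (disjointed_subset C n)
  simp_rw [← iUnion_disjointed (f := C), count_section_iUnion hD (disjoint_disjointed C),
    count_section_of_injOn_fst (hDi _)]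
  exact Measurable.tsum fun n => measurable_one.indicator
    ((hD n).image_of_measurable_injOn measurable_fst (hDi n))

end FiniteSections

open ProbabilityTheory
open scoped ENNReal

section MassTransport

variable {X : Type*} [MeasurableSpace X] [StandardBorelSpace X] {F : Setoid X} {μ : Measure X}

theorem IsPreserving.measure_image_fst_eq_measure_image_snd (hFμ : IsPreserving F μ)
    {C : Set (X × X)} (hC : MeasurableSet C) (hfst : Set.InjOn Prod.fst C)
    (hsnd : Set.InjOn Prod.snd C) (hCF : ∀ p ∈ C, F p.1 p.2) :
    μ (Prod.fst '' C) = μ (Prod.snd '' C) := by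
  have := hC.standardBorel
  have hemb : MeasurableEmbedding fun p : C => (p : X × X).1 :=
    (measurable_fst.comp measurable_subtype_coe).measurableEmbedding hfst.injective
  let φ : X → X := Function.extend (fun p : C => (p : X × X).1) (fun p => (p : X × X).2) id
  have hφ : ∀ p ∈ C, φ p.1 = p.2 := fun p hp => hemb.injective.extend_apply _ _ ⟨p, hp⟩
  refine hFμ _ _ φ (hC.image_of_measurable_injOn measurable_fst hfst)
    (hC.image_of_measurable_injOn measurable_snd hsnd)
    (hemb.measurable_extend (measurable_snd.comp measurable_subtype_coe) measurable_id)
    ⟨?_, ?_, ?_⟩ ?_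
  · rintro _ ⟨p, hp, rfl⟩
    exact ⟨p, hp, (hφ p hp).symm⟩
  · rintro _ ⟨p, hp, rfl⟩ _ ⟨q, hq, rfl⟩ hpq
    rw [hφ p hp, hφ q hq] at hpq
    rw [hsnd hp hq hpq]
  · rintro _ ⟨p, hp, rfl⟩
    exact ⟨p.1, Set.mem_image_of_mem _ hp, hφ p hp⟩
  · rintro _ ⟨p, hp, rfl⟩
    exact (hφ p hp).symm ▸ hCF p hp

theorem exists_iUnion_injOn_fst_injOn_snd {R : Set (X × X)} (hR : MeasurableSet R)
    (hrow : ∀ x, {y | (x, y) ∈ R}.Finite) (hcol : ∀ y, {x | (x, y) ∈ R}.Finite) :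
    ∃ C : ℕ → Set (X × X), (∀ n, MeasurableSet (C n)) ∧ (∀ n, Set.InjOn Prod.fst (C n)) ∧
      (∀ n, Set.InjOn Prod.snd (C n)) ∧ Pairwise (Function.onFun Disjoint C) ∧ ⋃ n, C n = R := by
  obtain ⟨A, hA, hAi, hAR⟩ := exists_iUnion_injOn_fst hR hrow
  obtain ⟨B, hB, hBi, hBR⟩ := exists_iUnion_injOn_fst (measurable_swap hR) hcol
  let D : ℕ → Set (X × X) := fun k => A k.unpair.1 ∩ Prod.swap ⁻¹' B k.unpair.2
  have hD : ∀ k, MeasurableSet (D k) := fun k => (hA _).inter (measurable_swap (hB _))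
  have iUnion_D : ⋃ k, D k = R := by
    ext p
    have hpA : p ∈ R ↔ ∃ m, p ∈ A m := by rw [← hAR, Set.mem_iUnion]
    have hpB : p ∈ R ↔ ∃ n, p.swap ∈ B n := by
      rw [← Set.mem_iUnion, hBR, Set.mem_preimage, Prod.swap_swap]
    rw [Set.mem_iUnion]
    refine ⟨fun ⟨k, hk⟩ => hpA.2 ⟨_, hk.1⟩, fun hp => ?_⟩
    obtain ⟨m, hm⟩ := hpA.1 hp
    obtain ⟨n, hn⟩ := hpB.1 hp
    exact ⟨Nat.pair m n, by simpa [D] using ⟨hm, hn⟩⟩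
  refine ⟨disjointed D, fun k => .disjointed hD k, fun k => ?_, fun k => ?_,
    disjoint_disjointed D, by rw [iUnion_disjointed, iUnion_D]⟩
  · exact (hAi _).mono ((disjointed_subset D k).trans Set.inter_subset_left)
  · intro p hp q hq hpq
    exact Prod.swap_injective
      (hBi _ (disjointed_subset D k hp).2 (disjointed_subset D k hq).2 hpq)

/-- The **mass transport principle**. -/
theorem IsPreserving.lintegral_count_section_swap (hFμ : IsPreserving F μ) {R : Set (X × X)}
    (hR : MeasurableSet R) (hRF : ∀ p ∈ R, F p.1 p.2) (hrow : ∀ x, {y | (x, y) ∈ R}.Finite)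
    (hcol : ∀ y, {x | (x, y) ∈ R}.Finite) :
    ∫⁻ x, Measure.count {y | (x, y) ∈ R} ∂μ = ∫⁻ y, Measure.count {x | (x, y) ∈ R} ∂μ := by
  obtain ⟨C, hC, hfst, hsnd, hCd, rfl⟩ := exists_iUnion_injOn_fst_injOn_snd hR hrow hcol
  have integral_rows : ∀ C : ℕ → Set (X × X), (∀ n, MeasurableSet (C n)) →
      (∀ n, Set.InjOn Prod.fst (C n)) → Pairwise (Function.onFun Disjoint C) →
      ∫⁻ x, Measure.count (Prod.mk x ⁻¹' ⋃ n, C n) ∂μ = ∑' n, μ (Prod.fst '' C n) := by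
    intro C hC hfst hCd
    have hA : ∀ n, MeasurableSet (Prod.fst '' C n) := fun n =>
      (hC n).image_of_measurable_injOn measurable_fst (hfst n)
    simp_rw [count_section_iUnion hC hCd, count_section_of_injOn_fst (hfst _)]
    rw [lintegral_tsum fun n => (measurable_one.indicator (hA n)).aemeasurable]
    exact tsum_congr fun n => lintegral_indicator_one (hA n)
  have integral_cols := integral_rows (fun n => Prod.swap ⁻¹' C n)
    (fun n => measurable_swap (hC n))
    (fun n p hp q hq hpq => Prod.swap_injective (hsnd n hp hq hpq))
    fun m n hmn => (hCd hmn).preimage _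
  rw [← Set.preimage_iUnion] at integral_cols
  refine (integral_rows C hC hfst hCd).trans (Eq.trans (tsum_congr fun n => ?_) integral_cols.symm)
  rw [← Set.image_swap_eq_preimage_swap, Set.image_image]
  exact hFμ.measure_image_fst_eq_measure_image_snd (hC n) (hfst n) (hsnd n) fun p hp =>
    hRF p (Set.mem_iUnion_of_mem n hp)

theorem IsPreserving.setLIntegral_count_inter (hFμ : IsPreserving F μ) (hF : IsFiniteBorel F)
    {A B S : Set X} (hA : MeasurableSet A) (hB : MeasurableSet B) (hS : MeasurableSet S)
    (hSF : InvariantSet F S) :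
    ∫⁻ x in A ∩ S, Measure.count ({y | F x y} ∩ B) ∂μ =
      ∫⁻ y in B ∩ S, Measure.count ({x | F y x} ∩ A) ∂μ := by
  let R : Set (X × X) := {p | F p.1 p.2 ∧ p.1 ∈ A ∩ S ∧ p.2 ∈ B}
  have hR : MeasurableSet R :=
    hF.1.inter ((measurable_fst (hA.inter hS)).inter (measurable_snd hB))
  have indicator_count : ∀ (T C : Set X) (x : X),
      T.indicator (fun x => Measure.count ({y | F x y} ∩ C)) x =
        Measure.count {y | x ∈ T ∧ F x y ∧ y ∈ C} := fun T C x => by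
    by_cases hx : x ∈ T
    · simp only [hx, Set.indicator_of_mem, true_and]
      rfl
    · simp [hx]
  have row : ∀ x, {y | x ∈ A ∩ S ∧ F x y ∧ y ∈ B} = {y | (x, y) ∈ R} := fun x =>
    Set.ext fun _ => and_left_comm
  have col : ∀ y, {x | y ∈ B ∩ S ∧ F y x ∧ x ∈ A} = {x | (x, y) ∈ R} := fun y => Set.ext fun x =>
    ⟨fun ⟨⟨hyB, hyS⟩, hyx, hxA⟩ => ⟨F.symm hyx, ⟨hxA, (hSF y x hyx).1 hyS⟩, hyB⟩,
      fun ⟨hxy, ⟨hxA, hxS⟩, hyB⟩ => ⟨⟨hyB, (hSF x y hxy).1 hxS⟩, F.symm hxy, hxA⟩⟩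
  rw [← lintegral_indicator (hA.inter hS), ← lintegral_indicator (hB.inter hS)]
  simp_rw [indicator_count, row, col]
  exact hFμ.lintegral_count_section_swap hR (fun p hp => hp.1)
    (fun x => (hF.2 x).subset fun y hy => hy.1)
    fun y => (hF.2 y).subset fun x hx => F.symm hx.1

end MassTransport

section ClassKernel

theorem setOf_rel_eq_of_rel {X : Type*} {F : Setoid X} {x y : X} (hxy : F x y) :
    {z | F x z} = {z | F y z} :=
  Set.ext fun _ => ⟨F.trans (F.symm hxy), F.trans hxy⟩

theorem uniformOn_class_apply {X : Type*} [MeasurableSpace X] [MeasurableSingletonClass X]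
    {F : Setoid X} (hF : ∀ x, {y | F x y}.Finite) (x : X) (B : Set X) :
    uniformOn {y | F x y} B =
      (Measure.count {y | F x y})⁻¹ * Measure.count ({y | F x y} ∩ B) :=
  cond_apply (hF x).measurableSet _ _

variable {X : Type*} [MeasurableSpace X] [StandardBorelSpace X] {F : Setoid X} {μ : Measure X}

theorem IsFiniteBorel.measurable_count_inter (hF : IsFiniteBorel F) {B : Set X}
    (hB : MeasurableSet B) : Measurable fun x => Measure.count ({y | F x y} ∩ B) :=
  measurable_count_section (R := {p | F p.1 p.2 ∧ p.2 ∈ B}) (hF.1.inter (measurable_snd hB))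
    fun x => (hF.2 x).subset fun _ hy => hy.1

theorem IsFiniteBorel.measurable_count_class (hF : IsFiniteBorel F) :
    Measurable fun x => Measure.count {y | F x y} := by
  simpa using hF.measurable_count_inter MeasurableSet.univ

/-- The Markov kernel that moves a point to a uniformly random point of its `F`-class. The finite
mean of `f` is the integral of `f` against it. -/
noncomputable def classKernel (hF : IsFiniteBorel F) : Kernel X X where
  toFun x := uniformOn {y | F x y}
  measurable' := Measure.measurable_of_measurable_coe _ fun B hB => by
    simp_rw [uniformOn_class_apply hF.2]
    exact hF.measurable_count_class.inv.mul (hF.measurable_count_inter hB)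

theorem classKernel_apply (hF : IsFiniteBorel F) (x : X) :
    classKernel hF x = uniformOn {y | F x y} := rfl

instance (hF : IsFiniteBorel F) : IsMarkovKernel (classKernel hF) :=
  ⟨fun x => isProbabilityMeasure_uniformOn (hF.2 x) ⟨x, F.refl x⟩⟩

theorem IsPreserving.isReversible_classKernel (hFμ : IsPreserving F μ) (hF : IsFiniteBorel F) :
    (classKernel hF).IsReversible μ := by
  intro A B hA hB
  let S : ℕ → Set X := fun k => {x | Measure.count {y | F x y} = k}
  have hS : ∀ k, MeasurableSet (S k) := fun k =>
    hF.measurable_count_class (measurableSet_singleton _)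
  have hSF : ∀ k, InvariantSet F (S k) := fun k x y hxy => by
    simp only [S, Set.mem_ofPred_eq, setOf_rel_eq_of_rel hxy]
  have iUnion_S : ⋃ k, S k = Set.univ := Set.eq_univ_of_forall fun x => Set.mem_iUnion.2
    ⟨_, Measure.count_apply_finite _ (hF.2 x)⟩
  have disjoint_S : Pairwise (Function.onFun Disjoint S) := fun k l hkl =>
    Set.disjoint_left.2 fun x hk hl => hkl (by exact_mod_cast hk.symm.trans hl)
  have sum_S : ∀ A B, MeasurableSet A → MeasurableSet B → ∫⁻ x in A, classKernel hF x B ∂μ =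
      ∑' k : ℕ, (k : ℝ≥0∞)⁻¹ * ∫⁻ x in A ∩ S k, Measure.count ({y | F x y} ∩ B) ∂μ := by
    intro A B hA hB
    conv_lhs => rw [← Set.inter_univ A, ← iUnion_S, Set.inter_iUnion]
    rw [lintegral_iUnion (fun k => hA.inter (hS k))
      fun k l hkl => (disjoint_S hkl).mono Set.inter_subset_right Set.inter_subset_right]
    refine tsum_congr fun k => ?_
    rw [← lintegral_const_mul _ (hF.measurable_count_inter hB)]
    refine setLIntegral_congr_fun (hA.inter (hS k)) fun x hx => ?_
    rw [classKernel_apply, uniformOn_class_apply hF.2, show Measure.count {y | F x y} = k from hx.2]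
  rw [sum_S A B hA hB, sum_S B A hB hA]
  exact tsum_congr fun k => congrArg _ (hFμ.setLIntegral_count_inter hF hA hB (hS k) (hSF k))

theorem IsPreserving.invariant_classKernel (hFμ : IsPreserving F μ) (hF : IsFiniteBorel F) :
    (classKernel hF).Invariant μ :=
  (hFμ.isReversible_classKernel hF).invariant

end ClassKernel

section FiniteMean

theorem finiteMean_eq_integral_uniformOn {X : Type*} [MeasurableSpace X]
    [MeasurableSingletonClass X] {F : Setoid X} (hF : ∀ x, {y | F x y}.Finite) (f : X → ℝ) (x : X) :
    finiteMean F f x = ∫ y, f y ∂uniformOn {y | F x y} := by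
  have hs := hF x
  generalize hsx : {y | F x y} = s at hs
  lift s to Finset X using hs
  have hint : IntegrableOn f s Measure.count := by
    rw [← Set.biUnion_of_singleton (s : Set X), integrableOn_finite_biUnion s.finite_toSet]
    exact fun y _ => integrableOn_singleton (hx := by simp [lt_top_iff_ne_top])
  rw [finiteMean, hsx, uniformOn, ProbabilityTheory.cond, integral_smul_measure,
    setIntegral_finset _ hint, finsum_mem_coe_finset, Set.ncard_coe_finset,
    Measure.count_apply_finset]
  simp [div_eq_inv_mul]

theorem finiteMean_eq_of_rel {X : Type*} {F : Setoid X} (f : X → ℝ) {x y : X} (hxy : F x y) :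
    finiteMean F f x = finiteMean F f y := by
  simp only [finiteMean, setOf_rel_eq_of_rel hxy]

theorem finiteMean_const {X : Type*} {F : Setoid X} {x : X} (hx : {y | F x y}.Finite) (c : ℝ) :
    finiteMean F (fun _ => c) x = c := by
  have hcard : {y | F x y}.ncard ≠ 0 := Set.ncard_ne_zero_of_mem (a := x) (F.refl x) hx
  rw [finiteMean, finsum_mem_eq_finite_toFinset_sum _ hx, Finset.sum_const,
    ← Set.ncard_eq_toFinset_card _ hx, nsmul_eq_mul,
    mul_div_cancel_left₀ c (Nat.cast_ne_zero.2 hcard)]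

theorem finiteMean_indicator {X : Type*} {F : Setoid X} {S : Set X} (hS : InvariantSet F S)
    (f : X → ℝ) : finiteMean F (S.indicator f) = S.indicator (finiteMean F f) := by
  ext x
  by_cases hx : x ∈ S
  · rw [Set.indicator_of_mem hx, finiteMean, finiteMean]
    congr 1
    exact finsum_mem_congr rfl fun y hy => Set.indicator_of_mem ((hS x y hy).1 hx) f
  · have hzero : ∀ y ∈ {y | F x y}, S.indicator f y = 0 := fun y hy =>
      Set.indicator_of_notMem (mt (hS x y hy).2 hx) f
    rw [Set.indicator_of_notMem hx, finiteMean, finsum_mem_congr rfl hzero, finsum_mem_zero,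
      zero_div]

variable {X : Type*} [MeasurableSpace X] [StandardBorelSpace X] {F : Setoid X} {μ : Measure X}
  {f : X → ℝ}

theorem IsFiniteBorel.finiteMean_eq_integral (hF : IsFiniteBorel F) (f : X → ℝ) :
    finiteMean F f = fun x => ∫ y, f y ∂classKernel hF x :=
  funext (finiteMean_eq_integral_uniformOn hF.2 f)

theorem IsFiniteBorel.measurable_finiteMean (hF : IsFiniteBorel F) (hf : Measurable f) :
    Measurable (finiteMean F f) := by
  rw [hF.finiteMean_eq_integral]
  exact hf.stronglyMeasurable.integral_kernel.measurable

theorem IsPreserving.integrable_finiteMean (hFμ : IsPreserving F μ) (hF : IsFiniteBorel F)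
    (hf : Integrable f μ) : Integrable (finiteMean F f) μ := by
  have hf' : Integrable f ((classKernel hF ∘ₖ Kernel.const Unit μ) ()) := by
    rwa [Kernel.comp_const, (hFμ.invariant_classKernel hF).def, Kernel.const_apply]
  rw [hF.finiteMean_eq_integral]
  exact hf'.integral_comp

theorem IsPreserving.integral_finiteMean (hFμ : IsPreserving F μ) (hF : IsFiniteBorel F)
    (hf : Integrable f μ) : ∫ x, finiteMean F f x ∂μ = ∫ x, f x ∂μ := by
  have hbind : (classKernel hF ∘ₖ Kernel.const Unit μ) () = μ := by
    rw [Kernel.comp_const, (hFμ.invariant_classKernel hF).def, Kernel.const_apply]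
  have hint := Kernel.integral_comp (hbind.symm ▸ hf)
  rw [hbind, Kernel.const_apply] at hint
  rw [hint, hF.finiteMean_eq_integral]

theorem IsPreserving.setIntegral_finiteMean (hFμ : IsPreserving F μ) (hF : IsFiniteBorel F)
    (hf : Integrable f μ) {S : Set X} (hS : MeasurableSet S) (hSF : InvariantSet F S) :
    ∫ x in S, finiteMean F f x ∂μ = ∫ x in S, f x ∂μ := by
  rw [← integral_indicator hS, ← integral_indicator hS, ← finiteMean_indicator hSF]
  exact hFμ.integral_finiteMean hF (hf.indicator hS)

end FiniteMean

section Invariants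

variable {X : Type*} [MeasurableSpace X] {E F : Setoid X}

/-- The σ-algebra of the `F`-invariant measurable sets. Conditioning on it is taking the mean
over `F`. -/
@[reducible]
def invariants (F : Setoid X) : MeasurableSpace X where
  MeasurableSet' A := MeasurableSet A ∧ InvariantSet F A
  measurableSet_empty := ⟨.empty, fun _ _ _ => Iff.rfl⟩
  measurableSet_compl _ hA := ⟨hA.1.compl, fun x y hxy => not_congr (hA.2 x y hxy)⟩
  measurableSet_iUnion A hA := ⟨.iUnion fun n => (hA n).1, fun x y hxy => by
    simp only [Set.mem_iUnion, fun n => (hA n).2 x y hxy]⟩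

theorem invariants_le (F : Setoid X) : invariants F ≤ ‹MeasurableSpace X› := fun _ hA => hA.1

theorem invariants_anti (hFE : F ≤ E) : invariants E ≤ invariants F :=
  fun _ hA => ⟨hA.1, fun x y hxy => hA.2 x y (hFE hxy)⟩

variable {Y : Type*} [MeasurableSpace Y] {g : X → Y}

theorem measurable_invariants (hg : Measurable g) (hgF : ∀ x y, F x y → g x = g y) :
    Measurable[invariants F] g := fun s hs => ⟨hg hs, fun x y hxy => by
  rw [Set.mem_preimage, Set.mem_preimage, hgF x y hxy]⟩

theorem IsWitness.le {Fn : ℕ → Setoid X} (hFn : IsWitness Fn F) (n : ℕ) : Fn n ≤ F :=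
  fun x y hxy => (hFn.2.2 x y).2 ⟨n, hxy⟩

theorem IsWitness.antitone_invariants {Fn : ℕ → Setoid X} (hFn : IsWitness Fn F) :
    Antitone fun n => invariants (Fn n) :=
  fun _ _ hmn => invariants_anti (hFn.2.1 hmn)

theorem IsWitness.iInf_invariants {Fn : ℕ → Setoid X} (hFn : IsWitness Fn F) :
    ⨅ n, invariants (Fn n) = invariants F := by
  refine le_antisymm (fun A hA => ?_) (le_iInf fun n => invariants_anti (hFn.le n))
  rw [MeasurableSpace.measurableSet_iInf] at hA
  refine ⟨(hA 0).1, fun x y hxy => ?_⟩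
  obtain ⟨n, hn⟩ := (hFn.2.2 x y).1 hxy
  exact (hA n).2 x y hn

theorem IsPreserving.mono {μ : Measure X} (hEμ : IsPreserving E μ) (hFE : F ≤ E) :
    IsPreserving F μ :=
  fun A B φ hA hB hφ hAB hφF => hEμ A B φ hA hB hφ hAB fun x hx => hFE (hφF x hx)

variable [StandardBorelSpace X]

theorem IsFiniteBorel.measurable_invariants_finiteMean (hF : IsFiniteBorel F) {f : X → ℝ}
    (hf : Measurable f) : Measurable[invariants F] (finiteMean F f) :=
  measurable_invariants (hF.measurable_finiteMean hf) fun _ _ => finiteMean_eq_of_rel f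

theorem IsPreserving.finiteMean_ae_eq_condExp {μ : Measure X} [IsFiniteMeasure μ]
    (hFμ : IsPreserving F μ) (hF : IsFiniteBorel F) {f : X → ℝ} (hf : Measurable f)
    (hfμ : Integrable f μ) : finiteMean F f =ᵐ[μ] μ[f | invariants F] :=
  ae_eq_condExp_of_forall_setIntegral_eq (invariants_le F) hfμ
    (fun _ _ _ => (hFμ.integrable_finiteMean hF hfμ).integrableOn)
    (fun _ hS _ => hFμ.setIntegral_finiteMean hF hfμ hS.1 hS.2)
    (hF.measurable_invariants_finiteMean hf).stronglyMeasurable.aestronglyMeasurable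

end Invariants

section ReverseMartingale

open scoped NNReal

theorem tendsto_starProjection_iInf {𝕜 E ι : Type*} [RCLike 𝕜] [NormedAddCommGroup E]
    [InnerProductSpace 𝕜 E] [CompleteSpace E] [Preorder ι] {K : ι → Submodule 𝕜 E}
    [∀ i, (K i).HasOrthogonalProjection] [(⨅ i, K i).HasOrthogonalProjection] (hK : Antitone K)
    (x : E) :
    Tendsto (fun i => (K i).starProjection x) atTop (𝓝 ((⨅ i, K i).starProjection x)) := by
  have hclosure : (⨆ i, (K i)ᗮ).topologicalClosure = (⨅ i, K i)ᗮ := by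
    rw [← Submodule.orthogonal_orthogonal_eq_closure, ← Submodule.iInf_orthogonal]
    simp only [Submodule.orthogonal_orthogonal]
  have : (⨆ i, (K i)ᗮ).topologicalClosure.HasOrthogonalProjection := hclosure ▸ inferInstance
  have hperp := Submodule.starProjection_tendsto_closure_iSup (fun i => (K i)ᗮ)
    (fun _ _ hij => Submodule.orthogonal_le (hK hij)) x
  simp only [hclosure, Submodule.starProjection_orthogonal_val] at hperp
  simpa using hperp.const_sub x

variable {Ω : Type*} {m0 : MeasurableSpace Ω} {μ : Measure Ω} {m : ℕ → MeasurableSpace Ω}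

theorem aestronglyMeasurable_iInf {f : Ω → ℝ} (hm : Antitone m)
    (hf : ∀ n, AEStronglyMeasurable[m n] f μ) : AEStronglyMeasurable[⨅ n, m n] f μ := by
  choose g hg hfg using hf
  have hlim : Measurable[⨅ n, m n] fun x => limsup (g · x) atTop := by
    intro s hs
    rw [MeasurableSpace.measurableSet_iInf]
    intro n
    have hn : Measurable[m n] fun x => limsup (fun k => g (k + n) x) atTop :=
      Measurable.limsup fun k => (hg (k + n)).measurable.mono (hm (Nat.le_add_left n k)) le_rfl
    rw [show (fun x => limsup (fun k => g (k + n) x) atTop) = fun x => limsup (g · x) atTop from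
      funext fun x => limsup_nat_add (g · x) n] at hn
    exact hn hs
  refine ⟨_, hlim.stronglyMeasurable, ?_⟩
  filter_upwards [ae_all_iff.2 hfg] with x hx
  simp only [← hx, limsup_const]

variable [IsFiniteMeasure μ]

theorem tendsto_eLpNorm_two_condExp_iInf (hm : Antitone m) (hm0 : ∀ n, m n ≤ m0) {f : Ω → ℝ}
    (hf : MemLp f 2 μ) :
    Tendsto (fun n => eLpNorm (μ[f | m n] - μ[f | ⨅ n, m n]) 2 μ) atTop (𝓝 0) := by
  have hminf : ⨅ n, m n ≤ m0 := (iInf_le m 0).trans (hm0 0)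
  have iInf_lpMeas : lpMeas ℝ ℝ (⨅ n, m n) 2 μ = ⨅ n, lpMeas ℝ ℝ (m n) 2 μ := by
    ext g
    simp only [Submodule.mem_iInf, mem_lpMeas_iff_aestronglyMeasurable]
    exact ⟨fun hg n => hg.mono (iInf_le m n), aestronglyMeasurable_iInf hm⟩
  have (n : ℕ) : Fact (m n ≤ m0) := ⟨hm0 n⟩
  have : Fact (⨅ n, m n ≤ m0) := ⟨hminf⟩
  have : (⨅ n, lpMeas ℝ ℝ (m n) 2 μ).HasOrthogonalProjection := iInf_lpMeas ▸ inferInstance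
  have hproj := tendsto_starProjection_iInf (K := fun n => lpMeas ℝ ℝ (m n) 2 μ)
    (fun i j hij g hg => mem_lpMeas_iff_aestronglyMeasurable.2
      ((mem_lpMeas_iff_aestronglyMeasurable.1 hg).mono (hm hij))) hf.toLp
  simp only [← iInf_lpMeas] at hproj
  rw [Lp.tendsto_Lp_iff_tendsto_eLpNorm'] at hproj
  refine hproj.congr fun n => eLpNorm_congr_ae ?_
  exact (hf.condExpL2_ae_eq_condExp (𝕜 := ℝ) (hm0 n)).sub
    (hf.condExpL2_ae_eq_condExp (𝕜 := ℝ) hminf)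

theorem tendsto_eLpNorm_one_condExp_iInf_of_memLp_two (hm : Antitone m) (hm0 : ∀ n, m n ≤ m0)
    {f : Ω → ℝ} (hf : MemLp f 2 μ) :
    Tendsto (fun n => eLpNorm (μ[f | m n] - μ[f | ⨅ n, m n]) 1 μ) atTop (𝓝 0) := by
  have hmul := ENNReal.Tendsto.mul_const (tendsto_eLpNorm_two_condExp_iInf hm hm0 hf)
    (b := μ Set.univ ^ (1 / (1 : ℝ≥0∞).toReal - 1 / (2 : ℝ≥0∞).toReal))
    (.inr (ENNReal.rpow_ne_top_of_nonneg (by norm_num) (measure_ne_top μ _)))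
  rw [zero_mul] at hmul
  exact tendsto_of_tendsto_of_tendsto_of_le_of_le tendsto_const_nhds hmul (fun _ => zero_le)
    fun _ => eLpNorm_le_eLpNorm_mul_rpow_measure_univ one_le_two
      (integrable_condExp.sub integrable_condExp).1

theorem tendsto_eLpNorm_one_condExp_iInf (hm : Antitone m) (hm0 : ∀ n, m n ≤ m0) {f : Ω → ℝ}
    (hf : Integrable f μ) :
    Tendsto (fun n => eLpNorm (μ[f | m n] - μ[f | ⨅ n, m n]) 1 μ) atTop (𝓝 0) := by
  rw [ENNReal.tendsto_nhds_zero]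
  intro ε hε
  have hε3 : ε / 3 ≠ 0 := (ENNReal.div_pos hε.ne' (by simp)).ne'
  obtain ⟨g, hfg, hg⟩ :=
    (memLp_one_iff_integrable.2 hf).exists_simpleFunc_eLpNorm_sub_lt ENNReal.one_ne_top hε3
  have contraction : ∀ m', eLpNorm (μ[f | m'] - μ[g | m']) 1 μ ≤ ε / 3 := fun m' => by
    rw [← eLpNorm_congr_ae (condExp_sub hf (memLp_one_iff_integrable.1 hg) m')]
    exact (eLpNorm_condExp_le_eLpNorm _ le_rfl).trans hfg.le
  have hconv := tendsto_eLpNorm_one_condExp_iInf_of_memLp_two hm hm0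
    (g.memLp_of_isFiniteMeasure 2 μ)
  filter_upwards [ENNReal.tendsto_nhds_zero.1 hconv _ (pos_iff_ne_zero.2 hε3)] with n hn
  have integrable_sub : ∀ (h₁ h₂ : Ω → ℝ) m₁ m₂, Integrable (μ[h₁ | m₁] - μ[h₂ | m₂]) μ :=
    fun _ _ _ _ => integrable_condExp.sub integrable_condExp
  calc eLpNorm (μ[f | m n] - μ[f | ⨅ n, m n]) 1 μ
      = eLpNorm ((μ[f | m n] - μ[g | m n]) + (μ[g | m n] - μ[g | ⨅ n, m n])
          - (μ[f | ⨅ n, m n] - μ[g | ⨅ n, m n])) 1 μ := by congr 1; abel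
    _ ≤ eLpNorm (μ[f | m n] - μ[g | m n]) 1 μ + eLpNorm (μ[g | m n] - μ[g | ⨅ n, m n]) 1 μ
          + eLpNorm (μ[f | ⨅ n, m n] - μ[g | ⨅ n, m n]) 1 μ :=
        (eLpNorm_sub_le ((integrable_sub ..).1.add (integrable_sub ..).1) (integrable_sub ..).1
          le_rfl).trans
          (by gcongr; exact eLpNorm_add_le (integrable_sub ..).1 (integrable_sub ..).1 le_rfl)
    _ ≤ ε / 3 + ε / 3 + ε / 3 := by gcongr <;> apply contraction
    _ = ε := ENNReal.add_thirds ε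

theorem mul_measure_exists_le_abs_condExp_le (hm : Antitone m) (hm0 : ∀ n, m n ≤ m0) (f : Ω → ℝ)
    (c : ℝ≥0) : c * μ {x | ∃ n, c ≤ |(μ[f | m n]) x|} ≤ eLpNorm f 1 μ := by
  let B : ℕ → Set Ω := fun N => {x | ∃ n ≤ N, c ≤ |(μ[f | m n]) x|}
  have hB : Monotone B := fun M N hMN x ⟨n, hn, hx⟩ => ⟨n, hn.trans hMN, hx⟩
  have iUnion_B : {x | ∃ n, c ≤ |(μ[f | m n]) x|} = ⋃ N, B N := by
    ext x
    simp only [B, Set.mem_iUnion]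
    exact ⟨fun ⟨n, hx⟩ => ⟨n, n, le_rfl, hx⟩, fun ⟨_, n, _, hx⟩ => ⟨n, hx⟩⟩
  rw [iUnion_B, hB.measure_iUnion, ENNReal.mul_iSup]
  refine iSup_le fun N => ?_
  let 𝒢 : Filtration ℕ m0 := ⟨fun k => m (N - k), fun i j hij => hm (Nat.sub_le_sub_left hij N),
    fun k => hm0 (N - k)⟩
  have hM : Martingale (fun k => μ[f | m (N - k)]) 𝒢 μ := martingale_condExp f 𝒢 μ
  have hsub : Submartingale (fun k x => |(μ[f | m (N - k)]) x|) 𝒢 μ :=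
    hM.submartingale.sup hM.neg.submartingale
  have hmax := maximal_ineq hsub (fun k x => abs_nonneg _) (ε := c) N
  calc c * μ (B N) ≤ _ := by
        gcongr
        rintro x ⟨n, hn, hx⟩
        rw [← Nat.sub_sub_self hn] at hx
        exact hx.trans (Finset.le_sup' (fun k => |(μ[f | m (N - k)]) x|)
          (Finset.mem_range.2 (Nat.lt_succ_of_le (Nat.sub_le N n))))
    _ ≤ _ := hmax
    _ ≤ ENNReal.ofReal (∫ x, ‖(μ[f | m 0]) x‖ ∂μ) := by
        refine ENNReal.ofReal_le_ofReal ((setIntegral_le_integral (hsub.integrable N)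
          (ae_of_all _ fun _ => abs_nonneg _)).trans_eq ?_)
        simp only [Nat.sub_self, Real.norm_eq_abs]
    _ = eLpNorm (μ[f | m 0]) 1 μ := by
        rw [ofReal_integral_norm_eq_lintegral_enorm integrable_condExp,
          eLpNorm_one_eq_lintegral_enorm]
    _ ≤ eLpNorm f 1 μ := eLpNorm_condExp_le_eLpNorm f le_rfl

theorem ae_eventually_abs_condExp_sub_iInf_lt (hm : Antitone m) (hm0 : ∀ n, m n ≤ m0)
    {f : Ω → ℝ} (hf : Integrable f μ) {ε : ℝ≥0} (hε : 0 < ε) :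
    ∀ᵐ x ∂μ, ∀ᶠ n in atTop, |(μ[f | m n]) x - (μ[f | ⨅ n, m n]) x| < ε := by
  let g := μ[f | ⨅ n, m n]
  have condExp_sub_tail : ∀ N n,
      μ[μ[f | m N] - g | m (n + N)] =ᵐ[μ] μ[f | m (n + N)] - g := fun N n => by
    have hg : μ[g | m (n + N)] = g := condExp_of_stronglyMeasurable (hm0 _)
      (stronglyMeasurable_condExp.mono (iInf_le m _)) integrable_condExp
    have htower : μ[μ[f | m N] | m (n + N)] =ᵐ[μ] μ[f | m (n + N)] :=
      condExp_condExp_of_le (hm (Nat.le_add_left N n)) (hm0 N)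
    refine (condExp_sub integrable_condExp integrable_condExp _).trans ?_
    rw [hg]
    exact htower.sub .rfl
  have measure_le : ∀ N, ε * μ {x | ∃ᶠ n in atTop, ε ≤ |(μ[f | m n]) x - g x|} ≤
      eLpNorm (μ[f | m N] - g) 1 μ := fun N => by
    refine le_trans (mul_le_mul_right (measure_mono_ae ?_) _)
      (mul_measure_exists_le_abs_condExp_le (m := fun n => m (n + N))
        (fun i j hij => hm (Nat.add_le_add_right hij N)) (fun n => hm0 _) _ ε)
    filter_upwards [ae_all_iff.2 (condExp_sub_tail N)] with x hx hfreq
    obtain ⟨n, hNn, hn⟩ := frequently_atTop.1 hfreq N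
    refine ⟨n - N, ?_⟩
    rwa [hx, Nat.sub_add_cancel hNn]
  have hzero := ge_of_tendsto' (tendsto_eLpNorm_one_condExp_iInf hm hm0 hf) measure_le
  simpa [hε.ne', ae_iff, Filter.Frequently] using hzero

/-- **Reverse martingale convergence theorem**. -/
theorem ae_tendsto_condExp_iInf (hm : Antitone m) (hm0 : ∀ n, m n ≤ m0) {f : Ω → ℝ}
    (hf : Integrable f μ) :
    ∀ᵐ x ∂μ, Tendsto (fun n => (μ[f | m n]) x) atTop (𝓝 ((μ[f | ⨅ n, m n]) x)) := by
  have hclose := ae_all_iff.2 fun k : ℕ =>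
    ae_eventually_abs_condExp_sub_iInf_lt hm hm0 hf (ε := (k + 1 : ℝ≥0)⁻¹) (by positivity)
  filter_upwards [hclose] with x hx
  rw [Metric.nhds_basis_ball_inv_nat_succ.tendsto_right_iff]
  intro k _
  filter_upwards [hx k] with n hn
  simpa [Real.dist_eq] using hn

end ReverseMartingale

section HyperfiniteMean

variable {X : Type*} [MeasurableSpace X] [StandardBorelSpace X] {μ : Measure X}
  [IsFiniteMeasure μ] {F : Setoid X} {Fn : ℕ → Setoid X} {f : X → ℝ}

theorem IsWitness.ae_tendsto_condExp (hFn : IsWitness Fn F) (hFμ : IsPreserving F μ)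
    (hf : Measurable f) (hfμ : Integrable f μ) :
    ∀ᵐ x ∂μ, Tendsto (fun n => finiteMean (Fn n) f x) atTop (𝓝 ((μ[f | invariants F]) x)) := by
  have hmean := ae_all_iff.2 fun n =>
    (hFμ.mono (hFn.le n)).finiteMean_ae_eq_condExp (hFn.1 n) hf hfμ
  have hconv := ae_tendsto_condExp_iInf hFn.antitone_invariants (fun n => invariants_le _) hfμ
  rw [hFn.iInf_invariants] at hconv
  filter_upwards [hmean, hconv] with x hx hxconv
  simpa only [hx] using hxconv

theorem hyperfiniteMean_ae_eq_condExp (hF : IsHyperfinite F) (hFμ : IsPreserving F μ)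
    (hf : Measurable f) (hfμ : Integrable f μ) :
    hyperfiniteMean F f =ᵐ[μ] μ[f | invariants F] := by
  filter_upwards [hF.choose_spec.ae_tendsto_condExp hFμ hf hfμ] with x hx
  rw [hyperfiniteMean, dif_pos hF]
  exact hx.limUnder_eq

theorem IsWitness.ae_tendsto_hyperfiniteMean (hFn : IsWitness Fn F) (hFμ : IsPreserving F μ)
    (hf : Measurable f) (hfμ : Integrable f μ) :
    ∀ᵐ x ∂μ, Tendsto (fun n => finiteMean (Fn n) f x) atTop (𝓝 (hyperfiniteMean F f x)) := by
  filter_upwards [hFn.ae_tendsto_condExp hFμ hf hfμ,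
    hyperfiniteMean_ae_eq_condExp ⟨Fn, hFn⟩ hFμ hf hfμ] with x hx hxeq
  rwa [hxeq]

end HyperfiniteMean

section AEInvariant

variable {X : Type*} [MeasurableSpace X] {μ : Measure X} {E F : Setoid X} {f g : X → ℝ}

theorem AEInvariant.congr_ae (hf : AEInvariant E μ f) (hfg : f =ᵐ[μ] g) : AEInvariant E μ g := by
  obtain ⟨Z, -, hZ0, hfZ⟩ := hf
  obtain ⟨Z', hZZ', hZ', hZ'0⟩ := exists_measurable_superset_of_null (measure_union_null hZ0 hfg)
  refine ⟨Z', hZ', hZ'0, fun x hx y hy hxy => ?_⟩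
  have hgood : ∀ z ∉ Z', z ∉ Z ∧ f z = g z := fun z hz => by
    simpa [not_or] using mt (@hZZ' z) hz
  rw [← (hgood x hx).2, ← (hgood y hy).2, hfZ x (hgood x hx).1 y (hgood y hy).1 hxy]

theorem ErgodicWithin.aeInvariant (hFE : ErgodicWithin F E μ)
    (hf : Measurable[invariants F] f) : AEInvariant E μ f := by
  have hlevel : ∀ q : ℚ, MeasurableSet[invariants F] {x | (q : ℝ) < f x} := fun q =>
    hf measurableSet_Ioi
  choose Z hZ hZ0 hZE using fun q => hFE _ (hlevel q).1 (hlevel q).2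
  refine ⟨⋃ q, Z q, .iUnion hZ, measure_iUnion_null hZ0, ?_⟩
  have hle : ∀ x ∉ ⋃ q, Z q, ∀ y ∉ ⋃ q, Z q, E x y → f x ≤ f y := by
    intro x hx y hy hxy
    rw [Set.mem_iUnion, not_exists] at hx hy
    by_contra! hlt
    obtain ⟨q, hyq, hqx⟩ := exists_rat_btwn hlt
    exact hyq.not_gt ((hZE q x (hx q) y (hy q) hxy).1 hqx)
  exact fun x hx y hy hxy => le_antisymm (hle x hx y hy hxy) (hle y hy x hx (E.symm hxy))

theorem aeInvariantSet_of_forall_exists {A : Set X} (h : ∀ ε : ℝ, 0 < ε → ∃ S : Set X,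
      μ Sᶜ ≤ ENNReal.ofReal ε ∧ ∀ x ∈ S, ∀ y ∈ S, E x y → (x ∈ A ↔ y ∈ A)) :
    AEInvariantSet E μ A := by
  choose S hSμ hSA using fun j : ℕ => h ((1 / 2) ^ j) (by positivity)
  have hsum : ∑' j, μ (S j)ᶜ ≠ ⊤ := by
    refine ne_top_of_le_ne_top ?_ (ENNReal.tsum_le_tsum hSμ)
    rw [← ENNReal.ofReal_tsum_of_nonneg (fun j => by positivity) summable_geometric_two]
    exact ENNReal.ofReal_ne_top
  obtain ⟨Z, hsub, hZ, hZ0⟩ := exists_measurable_superset_of_null (ae_eventually_notMem hsum)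
  have eventually_mem : ∀ x ∉ Z, ∀ᶠ j in atTop, x ∈ S j := fun x hx => by
    simpa using mt (@hsub x) hx
  refine ⟨Z, hZ, hZ0, fun x hx y hy hxy => ?_⟩
  obtain ⟨j, hxj, hyj⟩ := ((eventually_mem x hx).and (eventually_mem y hy)).exists
  exact hSA j x hxj y hyj hxy

end AEInvariant

section Ties

theorem osc_lt_of_forall_abs_sub_le {X : Type*} {f : X → ℝ} {A : Set X} {c δ ε : ℝ}
    (h : ∀ y ∈ A, |f y - c| ≤ δ) (hδ : 2 * δ < ε) : osc f A < (ε : EReal) := by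
  have hsup : (⨆ y ∈ A, (f y : EReal)) ≤ ((c + δ : ℝ) : EReal) :=
    iSup₂_le fun y hy => EReal.coe_le_coe_iff.2 (by linarith [(abs_le.1 (h y hy)).2])
  have hinf : ((c - δ : ℝ) : EReal) ≤ ⨅ y ∈ A, (f y : EReal) :=
    le_iInf₂ fun y hy => EReal.coe_le_coe_iff.2 (by linarith [(abs_le.1 (h y hy)).1])
  refine (EReal.sub_le_sub hsup hinf).trans_lt ?_
  rw [← EReal.coe_sub, EReal.coe_lt_coe_iff]
  linarith

theorem abs_sub_lt_of_osc_lt {X : Type*} {f : X → ℝ} {A : Set X} {ε : ℝ}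
    (h : osc f A < (ε : EReal)) {y z : X} (hy : y ∈ A) (hz : z ∈ A) : |f y - f z| < ε := by
  have sub_lt : ∀ y ∈ A, ∀ z ∈ A, f y - f z < ε := fun y hy z hz => by
    have hlt := (EReal.sub_le_sub (le_iSup₂ (f := fun y _ => (f y : EReal)) y hy)
      (iInf₂_le (f := fun y _ => (f y : EReal)) z hz)).trans_lt h
    rwa [← EReal.coe_sub, EReal.coe_lt_coe_iff] at hlt
  exact abs_sub_lt_iff.2 ⟨sub_lt y hy z hz, sub_lt z hz y hy⟩

variable {X : Type*} [MeasurableSpace X] {μ : Measure X} {E F : Setoid X} {f g : X → ℝ} {ε : ℝ}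

theorem Ties.mono {ε' : ℝ} (h : Ties F E μ f ε) (hε : ε ≤ ε') : Ties F E μ f ε' := by
  obtain ⟨S, hS, hSF, hSμ, hosc⟩ := h
  exact ⟨S, hS, hSF, hSμ.trans (ENNReal.ofReal_le_ofReal hε), fun x hx =>
    (hosc x hx).trans_le (EReal.coe_le_coe_iff.2 hε)⟩

variable [StandardBorelSpace X]

theorem ties_of_forall_abs_sub_lt (hF : IsFiniteBorel F) (hf : Measurable f)
    (hg : Measurable[invariants F] g) (hε : 0 < ε) {S : Set X} (hS : MeasurableSet S)
    (hSF : InvariantSet F S) (hSμ : μ Sᶜ ≤ ENNReal.ofReal (ε / 7))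
    (hgS : ∀ x ∈ S, ∀ y ∈ S, E x y → |g x - g y| < ε / 7)
    (hfg : μ {x | ε / 7 ≤ |finiteMean F f x - g x|} ≤ ENNReal.ofReal (ε / 7)) :
    Ties F E μ f ε := by
  let T : Set X := {x | |finiteMean F f x - g x| < ε / 7}
  have hT : MeasurableSet[invariants F] T :=
    ((hF.measurable_invariants_finiteMean hf).sub hg)
      (measurableSet_lt measurable_id.abs measurable_const : MeasurableSet {r : ℝ | |r| < ε / 7})
  have hTc : Tᶜ = {x | ε / 7 ≤ |finiteMean F f x - g x|} := by ext x; simp [T]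
  refine ⟨S ∩ T, hS.inter hT.1, fun x y hxy => and_congr (hSF x y hxy) (hT.2 x y hxy), ?_, ?_⟩
  · calc μ (S ∩ T)ᶜ ≤ μ Sᶜ + μ Tᶜ := by rw [Set.compl_inter]; exact measure_union_le _ _
      _ ≤ ENNReal.ofReal (ε / 7) + ENNReal.ofReal (ε / 7) := add_le_add hSμ (hTc ▸ hfg)
      _ = ENNReal.ofReal (ε / 7 + ε / 7) :=
        (ENNReal.ofReal_add (by positivity) (by positivity)).symm
      _ ≤ ENNReal.ofReal ε := ENNReal.ofReal_le_ofReal (by linarith)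
  · rintro x ⟨hxS, hxT : |finiteMean F f x - g x| < ε / 7⟩
    refine osc_lt_of_forall_abs_sub_le (c := finiteMean F f x) (δ := 3 * (ε / 7)) ?_ (by linarith)
    rintro y ⟨⟨hyS, hyT : |finiteMean F f y - g y| < ε / 7⟩, hxy⟩
    have hgxy := abs_lt.1 (hgS x hxS y hyS hxy)
    have hx := abs_lt.1 hxT
    have hy := abs_lt.1 hyT
    exact abs_le.2 ⟨by linarith [hgxy.1, hx.2, hy.1], by linarith [hgxy.2, hx.1, hy.2]⟩

theorem IsPreserving.exists_invariantSet_subset_compl_of_null (hFμ : IsPreserving F μ)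
    (hF : IsFiniteBorel F) {N : Set X} (hN : MeasurableSet N) (hN0 : μ N = 0) :
    ∃ S : Set X, MeasurableSet S ∧ InvariantSet F S ∧ S ⊆ Nᶜ ∧ μ Sᶜ = 0 := by
  have hκ : Measurable fun x => classKernel hF x N := Kernel.measurable_coe _ hN
  refine ⟨{x | classKernel hF x N = 0}, hκ (measurableSet_singleton 0), fun x y hxy => ?_,
    fun x hx hxN => ?_, ?_⟩
  · simp only [Set.mem_ofPred_eq, classKernel_apply, setOf_rel_eq_of_rel hxy]
  · have hx0 : {y | F x y} ∩ N = ∅ := (uniformOn_eq_zero_iff (hF.2 x)).1 hx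
    exact hx0.subset ⟨F.refl x, hxN⟩
  · have hint : ∫⁻ x, classKernel hF x N ∂μ = 0 := by
      rw [← Measure.bind_apply hN (classKernel hF).aemeasurable,
        (hFμ.invariant_classKernel hF).def, hN0]
    exact (lintegral_eq_zero_iff hκ).1 hint

variable [IsFiniteMeasure μ]

theorem IsPreserving.measure_le_abs_finiteMean_sub_le (hFμ : IsPreserving F μ)
    (hF : IsFiniteBorel F) (hf : Measurable f) (hfμ : Integrable f μ) (hg : Measurable g)
    (hgμ : Integrable g μ) (hε : 0 < ε) (hfg : ∫ x, |f x - g x| ∂μ ≤ ε ^ 2) :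
    μ {x | ε ≤ |finiteMean F f x - finiteMean F g x|} ≤ ENNReal.ofReal ε := by
  have hsub : (fun x => finiteMean F f x - finiteMean F g x) =ᵐ[μ] μ[f - g | invariants F] :=
    ((hFμ.finiteMean_ae_eq_condExp hF hf hfμ).sub
      (hFμ.finiteMean_ae_eq_condExp hF hg hgμ)).trans (condExp_sub hfμ hgμ _).symm
  have hint := (hFμ.integrable_finiteMean hF hfμ).sub (hFμ.integrable_finiteMean hF hgμ)
  have markov := calc
    ε * μ.real {x | ε ≤ |finiteMean F f x - finiteMean F g x|}
      ≤ ∫ x, |finiteMean F f x - finiteMean F g x| ∂μ :=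
        mul_meas_ge_le_integral_of_nonneg (ae_of_all _ fun _ => abs_nonneg _) hint.abs ε
    _ = ∫ x, |(μ[f - g | invariants F]) x| ∂μ :=
        integral_congr_ae (hsub.mono fun x hx => congrArg abs hx)
    _ ≤ ∫ x, |f x - g x| ∂μ := integral_abs_condExp_le _
    _ ≤ ε * ε := hfg.trans_eq (sq ε)
  rw [← ofReal_measureReal]
  exact ENNReal.ofReal_le_ofReal (le_of_mul_le_mul_left markov hε)

theorem Ties.of_integral_abs_sub_le (h : Ties F E μ f (ε / 7)) (hε : 0 < ε)
    (hF : IsFiniteBorel F) (hFμ : IsPreserving F μ) (hf : Measurable f) (hfμ : Integrable f μ)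
    (hg : Measurable g) (hgμ : Integrable g μ) (hfg : ∫ x, |f x - g x| ∂μ ≤ (ε / 7) ^ 2) :
    Ties F E μ g ε := by
  obtain ⟨S, hS, hSF, hSμ, hosc⟩ := h
  simp only [abs_sub_comm (f _)] at hfg
  exact ties_of_forall_abs_sub_lt hF hg (hF.measurable_invariants_finiteMean hf) hε hS hSF hSμ
    (fun x hx y hy hxy => abs_sub_lt_of_osc_lt (hosc x hx) ⟨hx, E.refl x⟩ ⟨hy, hxy⟩)
    (hFμ.measure_le_abs_finiteMean_sub_le hF hg hgμ hf hfμ (by positivity) hfg)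

theorem IsWitness.seqCauchyWithin_of_aeInvariant {Fn : ℕ → Setoid X} (hFn : IsWitness Fn F)
    (hFμ : IsPreserving F μ) (hf : Measurable f) (hfμ : Integrable f μ)
    (h : AEInvariant E μ (μ[f | invariants F])) : SeqCauchyWithin Fn E μ f := by
  intro ε hε
  obtain ⟨Z, hZ, hZ0, hZE⟩ := h
  have hmeas : TendstoInMeasure μ (fun n => finiteMean (Fn n) f) atTop (μ[f | invariants F]) :=
    tendstoInMeasure_of_tendsto_ae
      (fun n => ((hFn.1 n).measurable_finiteMean hf).aestronglyMeasurable)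
      (hFn.ae_tendsto_condExp hFμ hf hfμ)
  obtain ⟨n, hn⟩ := ((tendsto_order.1 (tendstoInMeasure_iff_dist.1 hmeas (ε / 7)
    (by positivity))).2 (ENNReal.ofReal (ε / 7)) (ENNReal.ofReal_pos.2 (by positivity))).exists
  obtain ⟨S, hS, hSF, hSZ, hS0⟩ :=
    (hFμ.mono (hFn.le n)).exists_invariantSet_subset_compl_of_null (hFn.1 n) hZ hZ0
  have hg : Measurable[invariants (Fn n)] (μ[f | invariants F]) :=
    stronglyMeasurable_condExp.measurable.mono (invariants_anti (hFn.le n)) le_rfl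
  refine ⟨n, ties_of_forall_abs_sub_lt (hFn.1 n) hf hg hε hS hSF (hS0.trans_le zero_le)
    (fun x hx y hy hxy => ?_) hn.le⟩
  rw [hZE x (hSZ hx) y (hSZ hy) hxy, sub_self, abs_zero]
  positivity

end Ties

section Glue

variable {X : Type*} {E F F₀ G : Setoid X}

/-- The points whose `F₀`-class is contained in their `G`-class. -/
def subordinateSet (F₀ G : Setoid X) : Set X :=
  {x | ∀ y, F₀ x y → G x y}

theorem invariantSet_subordinateSet : InvariantSet F₀ (subordinateSet F₀ G) := by
  have mem_of_rel : ∀ x y, F₀ x y → x ∈ subordinateSet F₀ G → y ∈ subordinateSet F₀ G :=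
    fun x y hxy hx z hyz => G.trans (G.symm (hx y hxy)) (hx z (F₀.trans hxy hyz))
  exact fun x y hxy => ⟨mem_of_rel x y hxy, mem_of_rel y x (F₀.symm hxy)⟩

theorem subordinateSet_mono {G' : Setoid X} (h : G ≤ G') :
    subordinateSet F₀ G ⊆ subordinateSet F₀ G' :=
  fun _ hx y hxy => h (hx y hxy)

/-- The equivalence relation that agrees with `G` on the set where `G` contains `F₀`, and with
`F₀` elsewhere. Unlike the join of `F₀` and `G`, it has finite classes whenever they do. -/
def glue (F₀ G : Setoid X) : Setoid X where
  r x y := F₀ x y ∨ (x ∈ subordinateSet F₀ G ∧ y ∈ subordinateSet F₀ G ∧ G x y)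
  iseqv :=
    { refl := fun x => Or.inl (F₀.refl x)
      symm := by
        rintro x y (h | ⟨hx, hy, h⟩)
        exacts [Or.inl (F₀.symm h), Or.inr ⟨hy, hx, G.symm h⟩]
      trans := by
        rintro x y z (h | ⟨hx, hy, h⟩) (h' | ⟨hy', hz, h'⟩)
        · exact Or.inl (F₀.trans h h')
        · have hx := (invariantSet_subordinateSet x y h).2 hy'
          exact Or.inr ⟨hx, hz, G.trans (hx y h) h'⟩
        · exact Or.inr ⟨hx, (invariantSet_subordinateSet y z h').1 hy, G.trans h (hy z h')⟩
        · exact Or.inr ⟨hx, hz, G.trans h h'⟩ }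

theorem le_glue : F₀ ≤ glue F₀ G :=
  fun _ _ h => Or.inl h

theorem glue_le (hF₀ : F₀ ≤ F) (hG : G ≤ F) : glue F₀ G ≤ F := by
  rintro x y (h | ⟨-, -, h⟩)
  exacts [hF₀ h, hG h]

theorem glue_mono {G' : Setoid X} (h : G ≤ G') : glue F₀ G ≤ glue F₀ G' := by
  rintro x y (hxy | ⟨hx, hy, hxy⟩)
  exacts [Or.inl hxy, Or.inr ⟨subordinateSet_mono h hx, subordinateSet_mono h hy, h hxy⟩]

variable [MeasurableSpace X] {Fn : ℕ → Setoid X}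

theorem IsWitness.eventually_rel (hFn : IsWitness Fn F) {x y : X} (hxy : F x y) :
    ∀ᶠ n in atTop, Fn n x y := by
  obtain ⟨n, hn⟩ := (hFn.2.2 x y).1 hxy
  exact eventually_atTop.2 ⟨n, fun m hnm => hFn.2.1 hnm hn⟩

theorem IsWitness.eventually_mem_subordinateSet (hFn : IsWitness Fn F) (hF₀F : F₀ ≤ F) {x : X}
    (hx : {y | F₀ x y}.Finite) : ∀ᶠ n in atTop, x ∈ subordinateSet F₀ (Fn n) :=
  (eventually_all_finite hx).2 fun _ hxy => hFn.eventually_rel (hF₀F hxy)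

variable [StandardBorelSpace X]

theorem IsFiniteBorel.measurableSet_subordinateSet (hF₀ : IsFiniteBorel F₀) (hG : IsBorel G) :
    MeasurableSet (subordinateSet F₀ G) := by
  have compl_eq : (subordinateSet F₀ G)ᶜ =
      Prod.fst '' ({p : X × X | F₀ p.1 p.2} \ {p | G p.1 p.2}) := by
    ext x
    simp [subordinateSet]
  rw [← MeasurableSet.compl_iff, compl_eq]
  exact measurableSet_image_fst_of_finite (hF₀.1.diff hG) fun x =>
    (hF₀.2 x).subset fun y hy => hy.1

theorem IsFiniteBorel.glue (hF₀ : IsFiniteBorel F₀) (hG : IsFiniteBorel G) :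
    IsFiniteBorel (glue F₀ G) := by
  have hY := hF₀.measurableSet_subordinateSet hG.1
  refine ⟨hF₀.1.union ((measurable_fst hY).inter ((measurable_snd hY).inter hG.1)), fun x =>
    ((hF₀.2 x).union (hG.2 x)).subset ?_⟩
  rintro y (h | ⟨-, -, h⟩)
  exacts [Or.inl h, Or.inr h]

theorem IsWitness.glue (hFn : IsWitness Fn F) (hF₀ : IsFiniteBorel F₀) (hF₀F : F₀ ≤ F) :
    IsWitness (fun n => glue F₀ (Fn n)) F := by
  refine ⟨fun n => hF₀.glue (hFn.1 n), fun n m hnm => glue_mono (hFn.2.1 hnm), fun x y =>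
    ⟨fun hxy => ?_, fun ⟨n, hn⟩ => glue_le hF₀F (hFn.le n) hn⟩⟩
  obtain ⟨n, hx, hy, hn⟩ := ((hFn.eventually_mem_subordinateSet hF₀F (hF₀.2 x)).and
    ((hFn.eventually_mem_subordinateSet hF₀F (hF₀.2 y)).and (hFn.eventually_rel hxy))).exists
  exact ⟨n, Or.inr ⟨hx, hy, hn⟩⟩

theorem cauchyWithin_of_forall_isWitness {μ : Measure X} {f : X → ℝ} (hF : IsHyperfinite F)
    (h : ∀ Fn : ℕ → Setoid X, IsWitness Fn F → SeqCauchyWithin Fn E μ f) :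
    CauchyWithin F E μ f := by
  intro ε hε F₀ hF₀ hF₀F
  obtain ⟨Fn, hFn⟩ := hF
  have hGn := hFn.glue hF₀ hF₀F
  obtain ⟨n, hn⟩ := h _ hGn ε hε
  exact ⟨glue F₀ (Fn n), hGn.1 n, le_glue, hGn.le n, hn⟩

end Glue

section DenseFamily

variable {X : Type*} [MeasurableSpace X] {μ : Measure X}

theorem exists_integral_abs_sub_le_of_dense {D : Set (X → ℝ)}
    (hD : Dense {g : X →₁[μ] ℝ | ∃ f ∈ D, g =ᵐ[μ] f}) {g : X → ℝ} (hg : Integrable g μ) {ε : ℝ}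
    (hε : 0 < ε) : ∃ f ∈ D, ∫ x, |f x - g x| ∂μ ≤ ε := by
  obtain ⟨u, ⟨f, hf, huf⟩, hdist⟩ := hD.exists_dist_lt (hg.toL1 g) hε
  refine ⟨f, hf, ?_⟩
  rw [dist_comm, dist_eq_norm, L1.norm_eq_integral_norm] at hdist
  refine (integral_congr_ae ?_).trans_le hdist.le
  filter_upwards [Lp.coeFn_sub u (hg.toL1 g), hg.coeFn_toL1, huf] with x hsub hgx hux
  rw [hsub, Pi.sub_apply, hgx, hux, Real.norm_eq_abs]

variable [StandardBorelSpace X]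

theorem exists_seq_dense_of_dense [IsFiniteMeasure μ] {D : Set (X → ℝ)}
    (hD : Dense {g : X →₁[μ] ℝ | ∃ f ∈ D, g =ᵐ[μ] f}) :
    ∃ d : ℕ → X → ℝ, (∀ k, d k ∈ D) ∧
      Dense {g : X →₁[μ] ℝ | ∃ f ∈ Set.range d, g =ᵐ[μ] f} := by
  have : Fact ((1 : ENNReal) ≠ ⊤) := ⟨ENNReal.one_ne_top⟩
  obtain ⟨t, htD, htc, htd⟩ := hD.exists_countable_dense_subset
  obtain ⟨u, rfl⟩ := htc.exists_eq_range htd.nonempty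
  choose d hdD hd using fun k => htD (Set.mem_range_self k)
  refine ⟨d, hdD, htd.mono ?_⟩
  rintro _ ⟨k, rfl⟩
  exact ⟨d k, Set.mem_range_self k, hd k⟩

variable {E F : Setoid X}

theorem isFiniteBorel_bot : IsFiniteBorel (⊥ : Setoid X) :=
  ⟨measurableSet_eq_fun measurable_fst measurable_snd, fun x =>
    (Set.finite_singleton x).subset fun _ hy => Eq.symm hy⟩

theorem exists_forall_seqCauchyWithin_of_forall_cauchyWithin {d : ℕ → X → ℝ}
    (h : ∀ k, CauchyWithin F E μ (d k)) :
    ∃ Fn : ℕ → Setoid X, (∀ n, IsFiniteBorel (Fn n) ∧ Fn n ≤ F) ∧ Monotone Fn ∧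
      ∀ k, SeqCauchyWithin Fn E μ (d k) := by
  have exists_ties : ∀ (n : ℕ) (G : {G : Setoid X // IsFiniteBorel G ∧ G ≤ F}),
      ∃ G' : {G : Setoid X // IsFiniteBorel G ∧ G ≤ F}, G ≤ G' ∧
        Ties G'.1 E μ (d n.unpair.1) (1 / ((n.unpair.2 : ℝ) + 1)) := by
    rintro n ⟨G, hG, hGF⟩
    obtain ⟨G', hG', hGG', hG'F, hties⟩ := h n.unpair.1 _ Nat.one_div_pos_of_nat G hG hGF
    exact ⟨⟨G', hG', hG'F⟩, hGG', hties⟩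
  choose next le_next ties_next using exists_ties
  let G : ℕ → {G : Setoid X // IsFiniteBorel G ∧ G ≤ F} := fun n =>
    Nat.rec ⟨⊥, isFiniteBorel_bot, bot_le⟩ next n
  refine ⟨fun n => (G n).1, fun n => (G n).2, monotone_nat_of_le_succ fun n => le_next n (G n),
    fun k ε hε => ?_⟩
  obtain ⟨j, hj⟩ := exists_nat_one_div_lt hε
  have hties : Ties (G (Nat.pair k j + 1)).1 E μ _ _ := ties_next (Nat.pair k j) _
  rw [Nat.unpair_pair] at hties
  exact ⟨Nat.pair k j + 1, hties.mono hj.le⟩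

variable [IsFiniteMeasure μ] {D : Set (X → ℝ)}

theorem seqCauchyWithin_of_dense {Fn : ℕ → Setoid X} (hFn : ∀ n, IsFiniteBorel (Fn n))
    (hFnμ : ∀ n, IsPreserving (Fn n) μ) (hDmeas : ∀ f ∈ D, Measurable f)
    (hDint : ∀ f ∈ D, Integrable f μ) (hD : Dense {g : X →₁[μ] ℝ | ∃ f ∈ D, g =ᵐ[μ] f})
    (h : ∀ f ∈ D, SeqCauchyWithin Fn E μ f) {g : X → ℝ} (hg : Measurable g)
    (hgμ : Integrable g μ) : SeqCauchyWithin Fn E μ g := by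
  intro ε hε
  obtain ⟨f, hf, hfg⟩ := exists_integral_abs_sub_le_of_dense hD hgμ
    (show 0 < (ε / 7) ^ 2 by positivity)
  obtain ⟨n, hn⟩ := h f hf (ε / 7) (by positivity)
  exact ⟨n, hn.of_integral_abs_sub_le hε (hFn n) (hFnμ n) (hDmeas f hf) (hDint f hf) hg hgμ hfg⟩

theorem exists_seqCauchyWithin_of_cauchyWithin (hFμ : IsPreserving F μ)
    (hDmeas : ∀ f ∈ D, Measurable f) (hDint : ∀ f ∈ D, Integrable f μ)
    (hD : Dense {g : X →₁[μ] ℝ | ∃ f ∈ D, g =ᵐ[μ] f}) (h : ∀ f ∈ D, CauchyWithin F E μ f) :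
    ∃ Fn : ℕ → Setoid X, (∀ n, IsFiniteBorel (Fn n) ∧ Fn n ≤ F) ∧ Monotone Fn ∧
      ∀ f ∈ D, SeqCauchyWithin Fn E μ f := by
  obtain ⟨d, hdD, hd⟩ := exists_seq_dense_of_dense hD
  obtain ⟨Fn, hFn, hmono, hFnd⟩ :=
    exists_forall_seqCauchyWithin_of_forall_cauchyWithin fun k => h (d k) (hdD k)
  refine ⟨Fn, hFn, hmono, fun f hf => seqCauchyWithin_of_dense (fun n => (hFn n).1)
    (fun n => hFμ.mono (hFn n).2) ?_ ?_ hd (Set.forall_mem_range.2 hFnd) (hDmeas f hf)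
    (hDint f hf)⟩
  exacts [Set.forall_mem_range.2 fun k => hDmeas _ (hdD k),
    Set.forall_mem_range.2 fun k => hDint _ (hdD k)]

end DenseFamily

section Ergodicity

variable {X : Type*} [MeasurableSpace X] {μ : Measure X} {E F : Setoid X}

theorem Ties.exists_invariant_on (hF : IsFiniteBorel F) {A : Set X} (hAF : InvariantSet F A)
    {ε : ℝ} (h : Ties F E μ (A.indicator fun _ => 1) ε) (hε : ε ≤ 1) :
    ∃ S : Set X, μ Sᶜ ≤ ENNReal.ofReal ε ∧ ∀ x ∈ S, ∀ y ∈ S, E x y → (x ∈ A ↔ y ∈ A) := by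
  obtain ⟨S, -, -, hSμ, hosc⟩ := h
  have hmean : finiteMean F (A.indicator fun _ => 1) = A.indicator fun _ => 1 := by
    rw [finiteMean_indicator hAF]
    exact congrArg A.indicator (funext fun x => finiteMean_const (hF.2 x) 1)
  rw [hmean] at hosc
  refine ⟨S, hSμ, fun x hx y hy hxy => ?_⟩
  have hlt := (abs_sub_lt_of_osc_lt (hosc x hx) ⟨hx, E.refl x⟩ ⟨hy, hxy⟩).trans_le hε
  by_cases hxA : x ∈ A <;> by_cases hyA : y ∈ A <;> simp [hxA, hyA] at hlt ⊢

variable [StandardBorelSpace X] [IsFiniteMeasure μ]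

theorem ergodicWithin_of_forall_exists_ties (hFμ : IsPreserving F μ) {D : Set (X → ℝ)}
    (hDmeas : ∀ f ∈ D, Measurable f) (hDint : ∀ f ∈ D, Integrable f μ)
    (hD : Dense {g : X →₁[μ] ℝ | ∃ f ∈ D, g =ᵐ[μ] f})
    (h : ∀ f ∈ D, ∀ ε : ℝ, 0 < ε → ∃ G : Setoid X, IsFiniteBorel G ∧ G ≤ F ∧ Ties G E μ f ε) :
    ErgodicWithin F E μ := by
  refine fun A hA hAF => aeInvariantSet_of_forall_exists fun ε hε => ?_
  have hε' : 0 < min ε 1 := lt_min hε one_pos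
  have hAμ : Integrable (A.indicator fun _ => (1 : ℝ)) μ := (integrable_const 1).indicator hA
  obtain ⟨f, hf, hfA⟩ := exists_integral_abs_sub_le_of_dense hD hAμ
    (show 0 < (min ε 1 / 7) ^ 2 by positivity)
  obtain ⟨G, hG, hGF, hties⟩ := h f hf (min ε 1 / 7) (by positivity)
  obtain ⟨S, hSμ, hSA⟩ := (hties.of_integral_abs_sub_le hε' hG (hFμ.mono hGF) (hDmeas f hf)
    (hDint f hf) (measurable_const.indicator hA) hAμ hfA).exists_invariant_on hG
    (fun x y hxy => hAF x y (hGF hxy)) (min_le_right ε 1)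
  exact ⟨S, hSμ.trans (ENNReal.ofReal_le_ofReal (min_le_left ε 1)), hSA⟩

end Ergodicity

end RelErg

theorem mainTheorem10_general {X : Type*} [MeasurableSpace X] [StandardBorelSpace X]
    (μ : Measure X) [IsFiniteMeasure μ] (E F : Setoid X)
    (hF : RelErg.IsHyperfinite F) (hFμ : RelErg.IsPreserving F μ) (D : Set (X → ℝ))
    (hDmeas : ∀ f ∈ D, Measurable f) (hDint : ∀ f ∈ D, Integrable f μ)
    (hDdense : Dense {g : X →₁[μ] ℝ | ∃ f ∈ D, g =ᵐ[μ] f}) :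
    (∀ f ∈ D, ∀ Fn : ℕ → Setoid X, RelErg.IsWitness Fn F →
      ∀ᵐ x ∂μ, Tendsto (fun n => RelErg.finiteMean (Fn n) f x) atTop
        (𝓝 (RelErg.hyperfiniteMean F f x))) ∧
    List.TFAE [
      RelErg.ErgodicWithin F E μ,
      ∀ f ∈ D, RelErg.AEInvariant E μ (RelErg.hyperfiniteMean F f),
      ∀ f ∈ D, ∀ Fn : ℕ → Setoid X, RelErg.IsWitness Fn F → RelErg.SeqCauchyWithin Fn E μ f,
      ∀ f ∈ D, RelErg.CauchyWithin F E μ f,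
      ∀ f ∈ D, ∃ Fn : ℕ → Setoid X, RelErg.IsWitness Fn F ∧ RelErg.SeqCauchyWithin Fn E μ f,
      ∃ Fn : ℕ → Setoid X, (∀ n, RelErg.IsFiniteBorel (Fn n) ∧ Fn n ≤ F) ∧ Monotone Fn ∧
        ∀ f ∈ D, RelErg.SeqCauchyWithin Fn E μ f] := by
  have hmean : ∀ f ∈ D, RelErg.hyperfiniteMean F f =ᵐ[μ] μ[f | RelErg.invariants F] :=
    fun f hf => RelErg.hyperfiniteMean_ae_eq_condExp hF hFμ (hDmeas f hf) (hDint f hf)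
  have ergodic := RelErg.ergodicWithin_of_forall_exists_ties (E := E) hFμ hDmeas hDint hDdense
  refine ⟨fun f hf Fn hFn =>
    hFn.ae_tendsto_hyperfiniteMean hFμ (hDmeas f hf) (hDint f hf), ?_⟩
  tfae_have 1 → 2 := fun h f hf =>
    (h.aeInvariant stronglyMeasurable_condExp.measurable).congr_ae (hmean f hf).symm
  tfae_have 2 → 3 := fun h f hf Fn hFn => hFn.seqCauchyWithin_of_aeInvariant hFμ (hDmeas f hf)
    (hDint f hf) ((h f hf).congr_ae (hmean f hf))
  tfae_have 3 → 4 := fun h f hf => RelErg.cauchyWithin_of_forall_isWitness hF (h f hf)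
  tfae_have 4 → 6 :=
    RelErg.exists_seqCauchyWithin_of_cauchyWithin hFμ hDmeas hDint hDdense
  tfae_have 3 → 5 := fun h f hf => hF.imp fun Fn hFn => ⟨hFn, h f hf Fn hFn⟩
  tfae_have 5 → 1 := fun h => ergodic fun f hf ε hε => by
    obtain ⟨Fn, hFn, hCauchy⟩ := h f hf
    exact (hCauchy ε hε).imp' Fn fun n hn => ⟨hFn.1 n, hFn.le n, hn⟩
  tfae_have 6 → 1 := fun ⟨Fn, hFn, _, hCauchy⟩ => ergodic fun f hf ε hε =>
    (hCauchy f hf ε hε).imp' Fn fun n hn => ⟨(hFn n).1, (hFn n).2, hn⟩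
  tfae_finish

theorem mainTheorem10 {X : Type*} [MeasurableSpace X] [StandardBorelSpace X]
    (μ : Measure X) [IsFiniteMeasure μ]
    (E F : Setoid X) (hE : RelErg.IsBorel E) (hFE : F ≤ E)
    (hF : RelErg.IsHyperfinite F) (hFμ : RelErg.IsPreserving F μ)
    (D : Set (X → ℝ))
    (hDmeas : ∀ f ∈ D, Measurable f)
    (hDbdd : ∀ f ∈ D, ∃ C : ℝ, ∀ x, |f x| ≤ C)
    (hDdense : Dense {g : X →₁[μ] ℝ | ∃ f ∈ D, g =ᵐ[μ] f}) :
    -- the hyperfinite mean is well defined almost everywhere, whatever the witness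
    (∀ f ∈ D, ∀ Fn : ℕ → Setoid X, RelErg.IsWitness Fn F →
      ∀ᵐ x ∂μ, Tendsto (fun n => RelErg.finiteMean (Fn n) f x) atTop
        (𝓝 (RelErg.hyperfiniteMean F f x))) ∧
    List.TFAE [
      RelErg.ErgodicWithin F E μ,
      ∀ f ∈ D, RelErg.AEInvariant E μ (RelErg.hyperfiniteMean F f),
      ∀ f ∈ D, ∀ Fn : ℕ → Setoid X, RelErg.IsWitness Fn F → RelErg.SeqCauchyWithin Fn E μ f,
      ∀ f ∈ D, RelErg.CauchyWithin F E μ f,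
      ∀ f ∈ D, ∃ Fn : ℕ → Setoid X, RelErg.IsWitness Fn F ∧ RelErg.SeqCauchyWithin Fn E μ f,
      ∃ Fn : ℕ → Setoid X, (∀ n, RelErg.IsFiniteBorel (Fn n) ∧ Fn n ≤ F) ∧ Monotone Fn ∧
        ∀ f ∈ D, RelErg.SeqCauchyWithin Fn E μ f] :=
  mainTheorem10_general μ E F hF hFμ D hDmeas (fun f hf => (hDbdd f hf).elim fun C hC =>
    .of_bound (hDmeas f hf).aestronglyMeasurable C (ae_of_all _ hC)) hDdense
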